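/- Let $X=(X(t):t\ge 0)$ be a (jointly measurable) time-homogeneous Markov process on a complete separable metric space $S$, started at $X(0)=x$, and write $\mathbb{E}_y$ for expectation when the process starts at $y$. Suppose that $X$ is $v$-geometrically ergodic: there are a measurable function $v\ge 1$, a probability $\pi$ on $S$, and constants $d<\infty$, $\alpha>0$ with $$\sup_{|h|\le v}\Big|\mathbb{E}_y h(X(t))-\int_S h\,d\pi\Big|\le d\,v(y)e^{-\alpha t}\qquad (t\ge 0,\ y\in S).$$ Let $f:S\to[0,\infty)$ be bounded and measurable with $\lambda^*:=\int f\,d\pi>0$, and put $$f_c=f-\lambda^*,\qquad g(y)=\int_0^\infty \mathbb{E}_y f_c(X(s))\,ds,\qquad \sigma^2=2\int_S f_c\,g\,d\pi .$$ For $0<\epsilon\le 1$ let $N_\epsilon$ be a doubly stochastic Poisson (Cox) process driven by $X$, with intensity $\lambda_\epsilon(t)=f(X(t/\epsilon))$, and let $N_0$ be a Poisson process with constant rate $\lambda^*$. Let the service times $V_1,V_2,\dots$ be iid with density $k(\cdot)$ on $[0,\infty)$ and tail $\bar K(s)=P(V_1>s)$, and suppose that the sequence is independent of $N_\epsilon$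 for each $\epsilon$ and independent of $N_0$. Let $Q_\epsilon(t)$ (respectively $Q_0(t)$) be the number in system at time $t$ of the infinite-server queue that starts empty and has arrival process $N_\epsilon$ (respectively $N_0$) and service times $V_1,V_2,\dots$. Then for every $t>0$ and every integer $k\ge 0$, $$P(Q_\epsilon(t)=k)=P(Q_0(t)=k)\left(1+\epsilon\left[\Big(\frac{k}{\mathbb{E}Q_0(t)}-1\Big)g(x)\bar K(t)+\frac12\Big(1-\frac{2k}{\mathbb{E}Q_0(t)}+\frac{k(k-1)}{(\mathbb{E}Q_0(t))^2}\Big)\eta^2\right]+o(\epsilon)\right)$$ as $\epsilon\downarrow 0$, where $$\eta^2=2\sigma^2\int_0^t\bar K(s)k(s)s\,ds+\sigma^2 t\,\bar K(t)^2 .$$ -/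

import Mathlib

open MeasureTheory ProbabilityTheory Filter Topology Asymptotics
open scoped NNReal

namespace RapidQueue

noncomputable section

/-! ### Markov processes and geometric ergodicity -/

/-- `P (t, x) B` is a time-homogeneous transition function on `S`: being a Markov kernel on
`[0, ∞) × S` it is a probability in `B` and jointly measurable in `(t, x)`; moreover
`P (0, x)` is the point mass at `x` and the Chapman-Kolmogorov equation holds. -/
structure IsTransitionFunction {S : Type*} [MeasurableSpace S]
    (P : Kernel (ℝ≥0 × S) S) : Prop where
  markovKernel : IsMarkovKernel P
  zero : ∀ x : S, P (0, x) = Measure.dirac x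
  chapmanKolmogorov : ∀ (s t : ℝ≥0) (x : S) (B : Set S), MeasurableSet B →
    P (s + t, x) B = ∫⁻ y, P (t, y) B ∂(P (s, x))

/-- The σ-algebra generated by the whole process `X`. -/
@[reducible] def pathSigma {S Ω : Type*} [MeasurableSpace S] (X : ℝ≥0 → Ω → S) : MeasurableSpace Ω :=
  ⨆ r : ℝ≥0, MeasurableSpace.comap (X r) inferInstance

/-- The σ-algebra generated by `X r`, `r ≤ s`. -/
@[reducible] def pastSigma {S Ω : Type*} [MeasurableSpace S] (X : ℝ≥0 → Ω → S) (s : ℝ≥0) :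
    MeasurableSpace Ω :=
  ⨆ r : ℝ≥0, ⨆ _ : r ≤ s, MeasurableSpace.comap (X r) inferInstance

/-- Under `μ`, the (jointly measurable) process `X` is a Markov process with transition
function `P` that starts at `x`. -/
structure IsMarkovProcessFrom {S Ω : Type*} [MeasurableSpace S] [MeasurableSpace Ω]
    (P : Kernel (ℝ≥0 × S) S) (x : S) (X : ℝ≥0 → Ω → S) (μ : Measure Ω) : Prop where
  measurable : Measurable fun p : ℝ≥0 × Ω => X p.1 p.2
  initial : ∀ᵐ ω ∂μ, X 0 ω = x
  markov : ∀ (s t : ℝ≥0) (B : Set S), MeasurableSet B →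
    μ⟦X (s + t) ⁻¹' B | pastSigma X s⟧ =ᵐ[μ] fun ω => (P (t, X s ω)).real B

/-- `v`-geometric ergodicity with limit law `π`:
`sup_{|h| ≤ v} |E_x h(X(t)) - ∫ h dπ| ≤ d v(x) exp(-α t)` for all `t` and `x`.
The integrability fields say that the expectations in the supremum exist. -/
structure IsGeometricallyErgodic {S : Type*} [MeasurableSpace S]
    (P : Kernel (ℝ≥0 × S) S) (v : S → ℝ) (π : Measure S) : Prop where
  measurable : Measurable v
  one_le : ∀ x, 1 ≤ v x
  isProbabilityMeasure : IsProbabilityMeasure π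
  integrable_limit : Integrable v π
  integrable : ∀ (t : ℝ≥0) (x : S), Integrable v (P (t, x))
  bound : ∃ d α : ℝ, 0 < α ∧ ∀ h : S → ℝ, Measurable h → (∀ y, |h y| ≤ v y) →
    ∀ (t : ℝ≥0) (x : S),
      |∫ y, h y ∂(P (t, x)) - ∫ y, h y ∂π| ≤ d * v x * Real.exp (-α * t)

/-- `f_c = f - E f(X(∞))`, where `X(∞)` has law `π`. -/
def centered {S : Type*} [MeasurableSpace S] (f : S → ℝ) (π : Measure S) (y : S) : ℝ :=
  f y - ∫ z, f z ∂π

/-- `g(x) = ∫_0^∞ E_x f_c(X(t)) dt`. -/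
def potential {S : Type*} [MeasurableSpace S] (P : Kernel (ℝ≥0 × S) S) (f : S → ℝ)
    (π : Measure S) (x : S) : ℝ :=
  ∫ t in Set.Ioi (0 : ℝ), ∫ y, centered f π y ∂(P (t.toNNReal, x))

/-- `σ² = 2 E f_c(X(∞)) g(X(∞))`. -/
def sigmaSq {S : Type*} [MeasurableSpace S] (P : Kernel (ℝ≥0 × S) S) (f : S → ℝ)
    (π : Measure S) : ℝ :=
  2 * ∫ y, centered f π y * potential P f π y ∂π

/-! ### Counting processes -/

/-- `N` is a counting process: almost every path starts at `0`, is non-decreasing and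
right-continuous. -/
structure IsCountingProcess {Ω : Type*} [MeasurableSpace Ω]
    (N : ℝ≥0 → Ω → ℕ) (μ : Measure Ω) : Prop where
  measurable : ∀ t, Measurable (N t)
  zero : ∀ᵐ ω ∂μ, N 0 ω = 0
  monotone : ∀ᵐ ω ∂μ, Monotone fun t => N t ω
  rightContinuous : ∀ᵐ ω ∂μ, ∀ t, ContinuousWithinAt (fun s => N s ω) (Set.Ici t) t

/-- The probability that a Poisson variable of mean `a` equals `j`. -/
def poissonWeight (a : ℝ) (j : ℕ) : ℝ := Real.exp (-a) * a ^ j / (j.factorial : ℝ)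

/-- `N` is a doubly stochastic Poisson (Cox) process driven by `X`, with intensity `lam`:
conditionally on the whole process `X`, its increments over successive intervals are
independent Poisson variables whose means are the integrals of `lam`. -/
structure IsCoxProcess {S Ω : Type*} [MeasurableSpace S] [MeasurableSpace Ω]
    (X : ℝ≥0 → Ω → S) (lam : ℝ≥0 → Ω → ℝ) (N : ℝ≥0 → Ω → ℕ) (μ : Measure Ω) : Prop where
  counting : IsCountingProcess N μ
  increments : ∀ (m : ℕ) (τ : Fin (m + 1) → ℝ≥0), Monotone τ → ∀ j : Fin m → ℕ,
    μ⟦{ω | ∀ i : Fin m, N (τ i.succ) ω = N (τ i.castSucc) ω + j i} | pathSigma X⟧ =ᵐ[μ]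
      fun ω => ∏ i : Fin m,
        poissonWeight (∫ s in (τ i.castSucc : ℝ)..(τ i.succ : ℝ), lam s.toNNReal ω) (j i)

/-- `N` is a Poisson process with constant rate `r`: its increments over successive
intervals are independent Poisson variables with means `r` times the lengths. -/
structure IsPoissonProcess {Ω : Type*} [MeasurableSpace Ω] (r : ℝ)
    (N : ℝ≥0 → Ω → ℕ) (μ : Measure Ω) : Prop where
  counting : IsCountingProcess N μ
  increments : ∀ (m : ℕ) (τ : Fin (m + 1) → ℝ≥0), Monotone τ → ∀ j : Fin m → ℕ,
    μ.real {ω | ∀ i : Fin m, N (τ i.succ) ω = N (τ i.castSucc) ω + j i} =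
      ∏ i : Fin m, poissonWeight (r * ((τ i.succ : ℝ) - (τ i.castSucc : ℝ))) (j i)

/-! ### The infinite-server queue -/

/-- The service times are iid with density `dens` on `[0, ∞)`. -/
structure IsServiceSequence {Ω : Type*} [MeasurableSpace Ω] (dens : ℝ → ℝ)
    (V : ℕ → Ω → ℝ) (μ : Measure Ω) : Prop where
  measurable : ∀ n, Measurable (V n)
  indep : iIndepFun V μ
  measurable_density : Measurable dens
  density_nonneg : ∀ y, 0 ≤ y → 0 ≤ dens y
  law : ∀ n, μ.map (V n) =
    (volume.restrict (Set.Ici (0 : ℝ))).withDensity fun y => ENNReal.ofReal (dens y)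

/-- The arrival epoch of customer `n`; customers are numbered `0, 1, 2, …`, so this is the
first time at which `n + 1` customers have arrived. -/
def arrivalTime {Ω : Type*} (N : ℝ≥0 → Ω → ℕ) (n : ℕ) (ω : Ω) : ℝ≥0 :=
  sInf {s : ℝ≥0 | n + 1 ≤ N s ω}

/-- The number-in-system at time `t` of the infinite-server queue that starts empty: the
number of customers that have arrived by time `t` and leave (one service time after their
arrival) after time `t`. -/
def numberInSystem {Ω : Type*} (N : ℝ≥0 → Ω → ℕ) (V : ℕ → Ω → ℝ) (t : ℝ≥0) (ω : Ω) : ℕ :=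
  ((Finset.range (N t ω)).filter fun n => (t : ℝ) < (arrivalTime N n ω : ℝ) + V n ω).card

/-- The tail `P(W > s)`. -/
def tail {Ω : Type*} [MeasurableSpace Ω] (W : Ω → ℝ) (μ : Measure Ω) (s : ℝ) : ℝ :=
  μ.real {ω | s < W ω}

/-- `2 σ² ∫_0^t K̄(s) k(s) s ds + σ² t K̄(t)²`, where `sig2 = σ²`. -/
def etaSq (sig2 : ℝ) (Kbar dens : ℝ → ℝ) (t : ℝ) : ℝ :=
  2 * sig2 * (∫ s in (0 : ℝ)..t, Kbar s * dens s * s) + sig2 * t * Kbar t ^ 2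

end

end RapidQueue

/-! Two facts carry the theorem: a formula for the law of the queue length, and a first-order
expansion for additive functionals of a fast Markov process.

Law of the queue. Given the arrivals, a customer arriving at time `s` is still present at `t` with
probability K̄(t - s), independently of the others. Thinning therefore makes the queue length mixed
Poisson, with random mean ∫_0^t λ(s) K̄(t - s) ds (`numberInSystem_law`). For the constant rate λ*
the mean is the number m = EQ₀(t). For the Cox input it is m + Y_t, where Y_r = ∫_0^r f_c(X(s/ε))
w(s) ds and w(s) = K̄(t - s). Hence P(Q_ε(t) = k) = E p_k(m + Y_t), with p_k the Poisson weight as a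
smooth function of its mean.

Expansion. Put ψ(y) = p_k(m + y). Along the Lipschitz path Y, ψ(Y_t) = ψ(0) + ψ'(0) Y_t + ∫_0^t
ψ''(Y_r) Y'_r (Y_t - Y_r) dr (`taylor_primitive`). This form of the remainder suits the Markov
property: the factor ψ''(Y_r) Y'_r depends on the past of r, while Y_t - Y_r is a future increment,
whose conditional mean given that past is ε w(r) g(X(r/ε)) + o(ε) for r < t, by exponential
ergodicity (`abs_integral_expect_sub_green_le`). So E Y_t / ε tends to w(0) g(x) = K̄(t) g(x). The
remainder divided by ε is asymptotically ∫_0^t E[ψ''(Y_r) f_c(X(r/ε)) g(X(r/ε))] w(r)² dr. Since Y_r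
vanishes in mean and X(r/ε) forgets its past, the inner expectation tends to ψ''(0) ∫ f_c g dπ
(`tendsto_integral_mul_comp`). No central limit theorem is needed; `tendsto_expansion` collects the
limits.

Identification. Integration by parts turns η² into σ² ∫_0^t K̄² (`etaSq_eq`), and p_k'/p_k and
p_k''/p_k at m are the two brackets of the statement. -/

namespace RapidQueue

/-! ### Calculus along absolutely continuous paths -/

/-- The primitive of a bounded function is Lipschitz. -/
theorem abs_integral_sub_le {ξ : ℝ → ℝ} {M : ℝ} (hξ : Measurable ξ) (hM : ∀ s, |ξ s| ≤ M)
    (c a b : ℝ) : |(∫ s in c..b, ξ s) - ∫ s in c..a, ξ s| ≤ M * |b - a| := by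
  have hi : ∀ a b, IntervalIntegrable ξ volume a b := fun a b =>
    (intervalIntegrable_const (c := M)).mono_fun hξ.aestronglyMeasurable
      (Eventually.of_forall fun s => by
        simpa [Real.norm_eq_abs] using (hM s).trans (le_abs_self M))
  rw [intervalIntegral.integral_interval_sub_left (hi _ _) (hi _ _)]
  exact intervalIntegral.norm_integral_le_of_norm_le_const
    (f := ξ) (C := M) fun s _ => hM s

/-- Second order Taylor formula along the primitive of a bounded function. -/
theorem taylor_primitive {ψ ψ' ψ'' ξ : ℝ → ℝ} {M T : ℝ} (hT : 0 ≤ T)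
    (hψ : ∀ y, HasDerivAt ψ (ψ' y) y) (hψ' : ∀ y, HasDerivAt ψ' (ψ'' y) y)
    (hc : Continuous ψ'') (hξ : Measurable ξ) (hM : ∀ s, |ξ s| ≤ M) :
    ψ (∫ s in 0..T, ξ s) = ψ 0 + ψ' 0 * (∫ s in 0..T, ξ s) +
      ∫ r in 0..T, ψ'' (∫ s in 0..r, ξ s) * ξ r *
        ((∫ s in 0..T, ξ s) - ∫ s in 0..r, ξ s) := by
  set Y : ℝ → ℝ := fun r => ∫ s in 0..r, ξ s with hY
  have hM0 : 0 ≤ M := (abs_nonneg _).trans (hM 0)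
  have hlip : LipschitzWith M.toNNReal Y := by
    refine LipschitzWith.of_dist_le_mul fun b a => ?_
    rw [Real.dist_eq, Real.dist_eq, Real.coe_toNNReal _ hM0]
    exact abs_integral_sub_le hξ hM 0 a b
  have hloc : LocallyIntegrable ξ volume := by
    refine (locallyIntegrable_const M).mono hξ.aestronglyMeasurable
      (Eventually.of_forall fun s => ?_)
    simpa [Real.norm_eq_abs] using (hM s).trans (le_abs_self M)
  -- The path stays in a compact interval, on which C¹ functions are Lipschitz; so their
  -- compositions with `Y` are absolutely continuous.
  have hmaps : Set.MapsTo Y (Set.uIcc 0 T) (Set.Icc (-(M * T)) (M * T)) := by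
    intro r hr
    rw [Set.uIcc_of_le hT] at hr
    have h := abs_integral_sub_le hξ hM 0 0 r
    simp only [intervalIntegral.integral_same, sub_zero, abs_of_nonneg hr.1] at h
    have h2 : M * r ≤ M * T := mul_le_mul_of_nonneg_left hr.2 hM0
    exact abs_le.1 (h.trans h2)
  have hcomp : ∀ p p' : ℝ → ℝ, (∀ y, HasDerivAt p (p' y) y) → Continuous p' →
      AbsolutelyContinuousOnInterval (fun r => p (Y r)) 0 T := by
    intro p p' hp hp'
    have hC : ContDiff ℝ 1 p := contDiff_one_iff_deriv.2
      ⟨fun y => (hp y).differentiableAt, by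
        rwa [show deriv p = p' from funext fun y => (hp y).deriv]⟩
    obtain ⟨K, hK⟩ := hC.contDiffOn.exists_lipschitzOnWith (by decide)
      (convex_Icc (-(M * T)) (M * T)) isCompact_Icc
    exact (hK.comp hlip.lipschitzOnWith hmaps).absolutelyContinuousOnInterval
  have hcψ' : Continuous ψ' := continuous_iff_continuousAt.2 fun y => (hψ' y).continuousAt
  have hYac : AbsolutelyContinuousOnInterval Y 0 T :=
    (hlip.lipschitzOnWith (s := _)).absolutelyContinuousOnInterval
  have hYT : AbsolutelyContinuousOnInterval (fun r => Y T - Y r) 0 T :=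
    ((LipschitzWith.const (Y T)).lipschitzOnWith.absolutelyContinuousOnInterval).sub hYac
  -- The formula is the fundamental theorem of calculus for r ↦ ψ(Y r) + ψ'(Y r)(Y T - Y r): in its
  -- derivative the two ψ' terms cancel and only the ψ'' term survives.
  have hF := (hcomp ψ ψ' hψ hcψ').add ((hcomp ψ' ψ'' hψ' hc).mul hYT)
  have h1 := hF.integral_deriv_eq_sub
  have h2 : ∫ r in 0..T, deriv ((fun r => ψ (Y r)) + (fun r => ψ' (Y r)) * fun r => Y T - Y r) r
      = ∫ r in 0..T, ψ'' (Y r) * ξ r * (Y T - Y r) := by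
    apply intervalIntegral.integral_congr_ae
    filter_upwards [_root_.LocallyIntegrable.ae_hasDerivAt_integral hloc] with r hr _
    have hr0 : HasDerivAt Y (ξ r) r := hr 0
    have e1 : HasDerivAt (fun r => ψ (Y r)) (ψ' (Y r) * ξ r) r := (hψ (Y r)).comp r hr0
    have e2 : HasDerivAt (fun r => ψ' (Y r)) (ψ'' (Y r) * ξ r) r := (hψ' (Y r)).comp r hr0
    have e3 : HasDerivAt (fun r => Y T - Y r) (-ξ r) r := hr0.const_sub _
    rw [(e1.add (e2.mul e3)).deriv]
    ring
  rw [h2] at h1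
  have hY0 : Y 0 = 0 := by simp [hY]
  simp only [Pi.add_apply, Pi.mul_apply, hY0, sub_self, sub_zero, mul_zero, add_zero] at h1
  simp only [hY] at h1 ⊢
  linarith

/-! ### The service time tail -/

section Tail

variable {Ω : Type*} [MeasurableSpace Ω] {μ : Measure Ω} {dens : ℝ → ℝ} {V : ℕ → Ω → ℝ}

theorem tail_nonneg (W : Ω → ℝ) (s : ℝ) : 0 ≤ tail W μ s := measureReal_nonneg

theorem tail_le_one [IsProbabilityMeasure μ] (W : Ω → ℝ) (s : ℝ) : tail W μ s ≤ 1 :=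
  measureReal_le_one

theorem tail_antitone [IsFiniteMeasure μ] (W : Ω → ℝ) : Antitone (tail W μ) := fun _ _ h =>
  measureReal_mono fun _ hω => lt_of_le_of_lt h hω

theorem IsServiceSequence.identDistrib (hV : IsServiceSequence dens V μ) (n : ℕ) :
    IdentDistrib (V n) (V 0) μ μ :=
  ⟨(hV.measurable n).aemeasurable, (hV.measurable 0).aemeasurable, by rw [hV.law, hV.law]⟩

theorem IsServiceSequence.integrableOn_density [IsProbabilityMeasure μ]
    (hV : IsServiceSequence dens V μ) : IntegrableOn dens (Set.Ici 0) volume := by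
  have h := hV.law 0
  have h1 : (μ.map (V 0)) Set.univ = 1 := by
    rw [Measure.map_apply (hV.measurable 0) MeasurableSet.univ]; simp
  rw [h, withDensity_apply _ MeasurableSet.univ, Measure.restrict_univ] at h1
  refine ⟨hV.measurable_density.aestronglyMeasurable, ?_⟩
  rw [hasFiniteIntegral_iff_ofReal, h1]
  · exact ENNReal.one_lt_top
  · exact (ae_restrict_iff' measurableSet_Ici).2 (Eventually.of_forall hV.density_nonneg)

theorem IsServiceSequence.tail_eq [IsProbabilityMeasure μ]
    (hV : IsServiceSequence dens V μ) {s : ℝ} (hs : 0 ≤ s) :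
    tail (V 0) μ s = 1 - ∫ y in 0..s, dens y := by
  have hI := hV.integrableOn_density
  have hsub : Set.Ioi s ⊆ Set.Ici 0 := fun y hy => hs.trans (le_of_lt hy)
  have key : ∀ s, 0 ≤ s → tail (V 0) μ s = ∫ y in Set.Ioi s, dens y := by
    intro s hs
    have hsub : Set.Ioi s ⊆ Set.Ici 0 := fun y hy => hs.trans (le_of_lt hy)
    have : tail (V 0) μ s = (μ.map (V 0)).real (Set.Ioi s) := by
      rw [map_measureReal_apply (hV.measurable 0) measurableSet_Ioi]; rfl
    rw [this, hV.law, measureReal_def, withDensity_apply _ measurableSet_Ioi,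
      Measure.restrict_restrict measurableSet_Ioi, Set.inter_eq_left.2 hsub,
      ← ofReal_integral_eq_lintegral_ofReal (hI.mono_set hsub), ENNReal.toReal_ofReal]
    · exact setIntegral_nonneg measurableSet_Ioi fun y hy => hV.density_nonneg y (hsub hy)
    · exact (ae_restrict_iff' measurableSet_Ioi).2
        (Eventually.of_forall fun y hy => hV.density_nonneg y (hsub hy))
  have h0 : ∫ y in Set.Ioi (0 : ℝ), dens y = 1 := by
    have h1 : (μ.map (V 0)) Set.univ = 1 := by
      rw [Measure.map_apply (hV.measurable 0) MeasurableSet.univ]; simp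
    rw [hV.law, withDensity_apply _ MeasurableSet.univ, Measure.restrict_univ,
      ← ofReal_integral_eq_lintegral_ofReal hI, ENNReal.ofReal_eq_one,
      integral_Ici_eq_integral_Ioi] at h1
    · exact h1
    · exact (ae_restrict_iff' measurableSet_Ici).2 (Eventually.of_forall hV.density_nonneg)
  rw [key s hs, ← h0, intervalIntegral.integral_of_le hs, eq_sub_iff_add_eq, add_comm,
    ← setIntegral_union (Set.Ioc_disjoint_Ioi le_rfl) measurableSet_Ioi
      (hI.mono_set fun y hy => hy.1.le) (hI.mono_set hsub),
    Set.Ioc_union_Ioi_eq_Ioi hs]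

theorem IsServiceSequence.intervalIntegrable_density [IsProbabilityMeasure μ]
    (hV : IsServiceSequence dens V μ) {t : ℝ} (ht : 0 ≤ t) :
    IntervalIntegrable dens volume 0 t := by
  rw [intervalIntegrable_iff, Set.uIoc_of_le ht]
  exact hV.integrableOn_density.mono_set fun y hy => hy.1.le

/-- Integration by parts: the variance parameter is `σ² ∫_0^t K̄(s)² ds`. -/
theorem IsServiceSequence.etaSq_eq [IsProbabilityMeasure μ]
    (hV : IsServiceSequence dens V μ) (sig2 : ℝ) {t : ℝ} (ht : 0 ≤ t) :
    etaSq sig2 (tail (V 0) μ) dens t = sig2 * ∫ s in 0..t, tail (V 0) μ s ^ 2 := by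
  set K := tail (V 0) μ
  have hi := hV.intervalIntegrable_density ht
  let G : ℝ → ℝ := fun s => 1 - ∫ y in 0..s, dens y
  have hKG : ∀ s ∈ Set.uIcc 0 t, K s = G s := fun s hs => by
    rw [Set.uIcc_of_le ht] at hs; exact hV.tail_eq hs.1
  have hG : AbsolutelyContinuousOnInterval G 0 t :=
    ((LipschitzWith.const (1 : ℝ)).lipschitzOnWith.absolutelyContinuousOnInterval).sub
      (hi.absolutelyContinuousOnInterval_intervalIntegral (c := 0) (by simp))
  have hid : AbsolutelyContinuousOnInterval (fun s : ℝ => s) 0 t :=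
    LipschitzWith.id.lipschitzOnWith.absolutelyContinuousOnInterval
  -- The density need not be continuous, so s·G(s)² is differentiable only almost everywhere;
  -- absolute continuity still gives the fundamental theorem of calculus.
  have h1 := (hid.mul (hG.mul hG)).integral_deriv_eq_sub
  have hcG : ContinuousOn G (Set.uIcc 0 t) := hG.continuousOn
  have e1 : IntervalIntegrable (fun s => G s ^ 2) volume 0 t := (hcG.pow 2).intervalIntegrable
  have e2 : IntervalIntegrable (fun s => 2 * (G s * dens s * s)) volume 0 t :=
    ((hi.continuousOn_mul hcG).mul_continuousOn continuousOn_id).const_mul 2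
  have h2 : ∫ s in 0..t, deriv ((fun s => s) * (G * G)) s
      = ∫ s in 0..t, (G s ^ 2 - 2 * (G s * dens s * s)) := by
    apply intervalIntegral.integral_congr_ae
    filter_upwards [hi.ae_hasDerivAt_integral] with s hs hs'
    have hs0 := hs (Set.uIoc_subset_uIcc hs') 0 (by simp)
    have hG' : HasDerivAt G (-dens s) s := hs0.const_sub 1
    rw [((hasDerivAt_id' s).mul (hG'.mul hG')).deriv]
    simp only [Pi.mul_apply]
    ring
  rw [h2, intervalIntegral.integral_sub e1 e2, intervalIntegral.integral_const_mul] at h1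
  have h3 : ∫ s in 0..t, K s * dens s * s = ∫ s in 0..t, G s * dens s * s :=
    intervalIntegral.integral_congr fun s hs => by simp only [hKG s hs]
  have h4 : ∫ s in 0..t, K s ^ 2 = ∫ s in 0..t, G s ^ 2 :=
    intervalIntegral.integral_congr fun s hs => by simp only [hKG s hs]
  simp only [Pi.mul_apply] at h1
  rw [etaSq, h3, h4, hKG t (by simp)]
  linear_combination (-sig2) * h1

end Tail

/-! ### Generating functions -/

theorem eq_of_hasSum_pow {a b : ℕ → ℝ} {F : ℝ → ℝ}
    (ha : ∀ z, |z| < 1 → HasSum (fun n => z ^ n * a n) (F z))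
    (hb : ∀ z, |z| < 1 → HasSum (fun n => z ^ n * b n) (F z)) : a = b := by
  have key : ∀ c : ℕ → ℝ, (∀ z, |z| < 1 → HasSum (fun n => z ^ n * c n) (F z)) →
      HasFPowerSeriesAt F (FormalMultilinearSeries.ofScalars ℝ c) 0 := by
    intro c hc
    rw [hasFPowerSeriesAt_iff]
    filter_upwards [Metric.ball_mem_nhds (0 : ℝ) one_pos] with z hz
    simpa [FormalMultilinearSeries.coeff_ofScalars] using hc z (by simpa using hz)
  exact FormalMultilinearSeries.ofScalars_series_injective (𝕜 := ℝ) ℝ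
    ((key a ha).eq_formalMultilinearSeries (key b hb))

theorem poissonWeight_nonneg {a : ℝ} (ha : 0 ≤ a) (j : ℕ) : 0 ≤ poissonWeight a j := by
  unfold poissonWeight; positivity

theorem hasSum_pow_mul_poissonWeight (a z : ℝ) :
    HasSum (fun j => z ^ j * poissonWeight a j) (Real.exp (-((1 - z) * a))) := by
  have h := (NormedSpace.expSeries_div_hasSum_exp (z * a)).mul_left (Real.exp (-a))
  rw [← Real.exp_eq_exp_ℝ, ← Real.exp_add] at h
  have e1 : (fun j => z ^ j * poissonWeight a j) =
      fun j : ℕ => Real.exp (-a) * ((z * a) ^ j / (j.factorial : ℝ)) := by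
    funext j
    simp only [poissonWeight, mul_pow]
    ring
  have e2 : -((1 - z) * a) = -a + z * a := by ring
  rw [e1, e2]
  exact h

theorem continuous_poissonWeight (j : ℕ) : Continuous fun a => poissonWeight a j := by
  unfold poissonWeight; fun_prop

theorem poissonMeasure_real_singleton_eq (a : ℝ) (ha : 0 ≤ a) (j : ℕ) :
    (poissonMeasure a.toNNReal).real {j} = poissonWeight a j := by
  rw [poissonMeasure_real_singleton, Real.coe_toNNReal a ha]; rfl

/-- The weights are the point masses of a product of Poisson measures. Integrability against that
measure gives summability over multi-indices, and Fubini factors the value into one-dimensional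
generating functions. -/
theorem hasSum_pi_poissonWeight {m : ℕ} (L a : Fin m → ℝ) (hL : ∀ i, 0 ≤ L i)
    (ha : ∀ i, |a i| ≤ 1) :
    HasSum (fun j : Fin m → ℕ => (∏ i, poissonWeight (L i) (j i)) * ∏ i, a i ^ j i)
      (∏ i, Real.exp (-((1 - a i) * L i))) := by
  have hprod : ∀ j : Fin m → ℕ, ‖∏ i, a i ^ j i‖ ≤ 1 := fun j => by
    rw [Real.norm_eq_abs, Finset.abs_prod]
    exact Finset.prod_le_one (fun i _ => abs_nonneg _)
      fun i _ => by rw [abs_pow]; exact pow_le_one₀ (abs_nonneg _) (ha i)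
  have hint : Integrable (fun j : Fin m → ℕ => ∏ i, a i ^ j i)
      (Measure.pi fun i => poissonMeasure (L i).toNNReal) :=
    Integrable.of_bound (measurable_of_countable _).aestronglyMeasurable 1
      (Eventually.of_forall hprod)
  have hsing : ∀ j : Fin m → ℕ, (Measure.pi fun i => poissonMeasure (L i).toNNReal).real {j}
      = ∏ i, poissonWeight (L i) (j i) := fun j => by
    rw [measureReal_def, Measure.pi_singleton, ENNReal.toReal_prod]
    exact Finset.prod_congr rfl fun i _ => poissonMeasure_real_singleton_eq _ (hL i) _
  have hsum1 : Summable fun j : Fin m → ℕ => ∏ i, poissonWeight (L i) (j i) := by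
    simp_rw [← hsing]
    have h1 : Integrable (fun _ : Fin m → ℕ => (1 : ℝ))
      (Measure.pi fun i => poissonMeasure (L i).toNNReal) := integrable_const 1
    rw [← Measure.sum_smul_dirac (Measure.pi fun i => poissonMeasure (L i).toNNReal)] at h1
    simpa [measureReal_def] using
      (integrable_sum_dirac_iff (fun j => by finiteness)).1 h1
  have hS : Summable fun j : Fin m → ℕ => (∏ i, poissonWeight (L i) (j i)) * ∏ i, a i ^ j i := by
    refine hsum1.of_norm_bounded fun j => ?_
    rw [norm_mul, Real.norm_of_nonneg
      (Finset.prod_nonneg fun i _ => poissonWeight_nonneg (hL i) _)]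
    exact mul_le_of_le_one_right
      (Finset.prod_nonneg fun i _ => poissonWeight_nonneg (hL i) _) (hprod j)
  have hval : ∏ i, Real.exp (-((1 - a i) * L i)) =
      ∑' j : Fin m → ℕ, (∏ i, poissonWeight (L i) (j i)) * ∏ i, a i ^ j i := by
    have h1 := integral_countable hint
    have h2 : ∫ j : Fin m → ℕ, ∏ i, a i ^ j i ∂(Measure.pi fun i => poissonMeasure (L i).toNNReal)
        = ∏ i, ∫ x, a i ^ x ∂(poissonMeasure (L i).toNNReal) :=
      integral_fintype_prod_eq_prod (fun i (x : ℕ) => a i ^ x)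
    simp only [hsing, smul_eq_mul] at h1
    rw [← h1, h2]
    refine Finset.prod_congr rfl fun i _ => ?_
    rw [integral_poissonMeasure, ← (hasSum_pow_mul_poissonWeight (L i) (a i)).tsum_eq]
    refine tsum_congr fun j => ?_
    rw [Real.coe_toNNReal _ (hL i), smul_eq_mul, mul_comm]; rfl
  rw [hval]
  exact hS.hasSum

section Mixed

variable {Ω : Type*} [MeasurableSpace Ω] {μ : Measure Ω} [IsProbabilityMeasure μ]

/-- The joint generating function of a vector with mixed Poisson law. -/
theorem integral_prod_pow_of_mixedPoisson {m : ℕ} {D : Ω → Fin m → ℕ} (hD : Measurable D)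
    {L : Fin m → Ω → ℝ} (hLm : ∀ i, Measurable (L i)) (hL : ∀ i ω, 0 ≤ L i ω)
    (hlaw : ∀ j : Fin m → ℕ, μ.real (D ⁻¹' {j}) = ∫ ω, ∏ i, poissonWeight (L i ω) (j i) ∂μ)
    {a : Fin m → ℝ} (ha : ∀ i, |a i| ≤ 1) :
    ∫ ω, ∏ i, a i ^ D ω i ∂μ = ∫ ω, ∏ i, Real.exp (-((1 - a i) * L i ω)) ∂μ := by
  have hprod : ∀ j : Fin m → ℕ, ‖∏ i, a i ^ j i‖ ≤ 1 := fun j => by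
    rw [Real.norm_eq_abs, Finset.abs_prod]
    exact Finset.prod_le_one (fun i _ => abs_nonneg _)
      fun i _ => by rw [abs_pow]; exact pow_le_one₀ (abs_nonneg _) (ha i)
  have : IsProbabilityMeasure (μ.map D) := Measure.isProbabilityMeasure_map hD.aemeasurable
  have hint : Integrable (fun j : Fin m → ℕ => ∏ i, a i ^ j i) (μ.map D) :=
    Integrable.of_bound (measurable_of_countable _).aestronglyMeasurable 1
      (Eventually.of_forall hprod)
  -- The case `a = 1` says that the weights sum to one, which makes them the dominating family when
  -- sum and expectation are exchanged.
  have hone : ∀ i, |(fun _ : Fin m => (1 : ℝ)) i| ≤ 1 := fun i => by simp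
  have hpw : ∀ j : Fin m → ℕ, ∀ ω, 0 ≤ ∏ i, poissonWeight (L i ω) (j i) := fun j ω =>
    Finset.prod_nonneg fun i _ => poissonWeight_nonneg (hL i ω) _
  have hpwm : ∀ j : Fin m → ℕ, Measurable fun ω => ∏ i, poissonWeight (L i ω) (j i) := fun j =>
    Finset.measurable_fun_prod _ fun i _ => (continuous_poissonWeight _).measurable.comp (hLm i)
  have hHS := fun ω => hasSum_pi_poissonWeight (fun i => L i ω) a (fun i => hL i ω) ha
  have hHS1 := fun ω => hasSum_pi_poissonWeight (fun i => L i ω) _ (fun i => hL i ω) hone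
  have hdom : HasSum (fun j : Fin m → ℕ =>
      ∫ ω, (∏ i, poissonWeight (L i ω) (j i)) * ∏ i, a i ^ j i ∂μ)
      (∫ ω, ∏ i, Real.exp (-((1 - a i) * L i ω)) ∂μ) := by
    refine hasSum_integral_of_dominated_convergence
      (fun j ω => ∏ i, poissonWeight (L i ω) (j i))
      (fun j => ((hpwm j).mul_const _).aestronglyMeasurable)
      (fun j => Eventually.of_forall fun ω => ?_) (Eventually.of_forall fun ω => ?_) ?_
      (Eventually.of_forall hHS)
    · rw [norm_mul, Real.norm_of_nonneg (hpw j ω)]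
      exact mul_le_of_le_one_right (hpw j ω) (hprod j)
    · simpa using (hHS1 ω).summable
    · have : (fun ω => ∑' j : Fin m → ℕ, ∏ i, poissonWeight (L i ω) (j i)) = fun _ => 1 := by
        funext ω
        simpa using (hHS1 ω).tsum_eq
      rw [this]; exact integrable_const 1
  have h1 := integral_countable hint
  rw [integral_map hD.aemeasurable (measurable_of_countable _).aestronglyMeasurable] at h1
  rw [h1, ← hdom.tsum_eq]
  refine tsum_congr fun j => ?_
  rw [map_measureReal_apply hD (measurableSet_singleton j), hlaw, smul_eq_mul,
    integral_mul_const]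

end Mixed

/-! ### Customers on a grid -/

/-- The index of the grid interval in which the counting sequence `n` exceeds `l`. -/
def gridIndex (n : ℕ → ℕ) (m l : ℕ) : ℕ := ((Finset.range m).filter fun i => n (i + 1) ≤ l).card

/-- By monotonicity, the grid intervals that end before customer `l` arrives form an initial
segment, so counting them yields the index of the interval of arrival. -/
theorem gridIndex_eq {n : ℕ → ℕ} (hn : Monotone n) {m l i : ℕ} (him : i < m)
    (h1 : n i ≤ l) (h2 : l < n (i + 1)) : gridIndex n m l = i := by
  have : (Finset.range m).filter (fun i => n (i + 1) ≤ l) = Finset.range i := by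
    ext j
    simp only [Finset.mem_filter, Finset.mem_range]
    constructor
    · rintro ⟨_, hj⟩
      by_contra hji
      have := hn (show i + 1 ≤ j + 1 by omega)
      omega
    · intro hj
      exact ⟨by omega, (hn (show j + 1 ≤ i by omega)).trans h1⟩
  rw [gridIndex, this, Finset.card_range]

theorem exists_grid {n : ℕ → ℕ} (h0 : n 0 = 0) {m l : ℕ} (hl : l < n m) :
    ∃ i < m, n i ≤ l ∧ l < n (i + 1) := by
  induction m with
  | zero => omega
  | succ m ih =>
    by_cases h : l < n m
    · obtain ⟨i, hi, h⟩ := ih h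
      exact ⟨i, by omega, h⟩
    · exact ⟨m, by omega, by omega, hl⟩

/-- Customers are grouped by interval of arrival: those of the `i`-th interval carry the consecutive
numbers in [n i, n (i + 1)) and contribute equal factors. -/
theorem prod_gridIndex {n : ℕ → ℕ} (hn : Monotone n) (h0 : n 0 = 0) (a : ℕ → ℝ) (m : ℕ) :
    ∏ l ∈ Finset.range (n m), a (gridIndex n m l) =
      ∏ i ∈ Finset.range m, a i ^ (n (i + 1) - n i) := by
  have key : ∀ (h : ℕ → ℝ) (k : ℕ), ∏ l ∈ Finset.range (n k), h l =
      ∏ i ∈ Finset.range k, ∏ l ∈ Finset.Ico (n i) (n (i + 1)), h l := by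
    intro h k
    induction k with
    | zero => simp [h0]
    | succ k ih =>
      rw [Finset.prod_range_succ, ← ih, Finset.prod_range_mul_prod_Ico _ (hn (Nat.le_succ k))]
  rw [key]
  refine Finset.prod_congr rfl fun i hi => ?_
  rw [Finset.prod_congr rfl fun l hl => ?_, Finset.prod_const, Nat.card_Ico]
  rw [Finset.mem_Ico] at hl
  rw [gridIndex_eq hn (Finset.mem_range.1 hi) hl.1 hl.2]

/-- The `i`-th point of the partition of `[0, t]` into `m` intervals of equal length. -/
noncomputable def gridPoint (t : ℝ≥0) (m i : ℕ) : ℝ≥0 := t * i / m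

theorem gridPoint_mono (t : ℝ≥0) (m : ℕ) : Monotone (gridPoint t m) := fun i j h => by
  unfold gridPoint; gcongr

theorem gridPoint_zero (t : ℝ≥0) (m : ℕ) : gridPoint t m 0 = 0 := by simp [gridPoint]

theorem gridPoint_self (t : ℝ≥0) {m : ℕ} (hm : m ≠ 0) : gridPoint t m m = t := by
  have : (m : ℝ≥0) ≠ 0 := by exact_mod_cast hm
  simp [gridPoint, this]

theorem gridPoint_succ (t : ℝ≥0) (m i : ℕ) :
    (gridPoint t m (i + 1) : ℝ) = gridPoint t m i + t / m := by
  simp only [gridPoint]; push_cast; ring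

section Queue

variable {Ω : Type*} {N : ℝ≥0 → Ω → ℕ} {V : ℕ → Ω → ℝ} {t : ℝ≥0}

/-- The number in system if each customer arrived at the last grid point before the true
arrival. -/
noncomputable def gridNumber (N : ℝ≥0 → Ω → ℕ) (V : ℕ → Ω → ℝ) (t : ℝ≥0) (m : ℕ) (ω : Ω) : ℕ :=
  ((Finset.range (N t ω)).filter fun l =>
    (t : ℝ) < gridPoint t m (gridIndex (fun i => N (gridPoint t m i) ω) m l) + V l ω).card

/-- Rounding moves each arrival to the left by at most `t / m`. A strict inequality `t < arrival +
V` survives once `t / m` is below the gap. A failing one, ties included, still fails after moving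
left. Only finitely many customers matter, so the numbers agree exactly from some `m` on. -/
theorem eventually_gridNumber_eq {ω : Ω} (hmono : Monotone fun s => N s ω) (h0 : N 0 ω = 0) :
    ∀ᶠ m : ℕ in atTop, gridNumber N V t m ω = numberInSystem N V t ω := by
  have key : ∀ l ∈ Finset.range (N t ω), ∀ᶠ m : ℕ in atTop,
      ((t : ℝ) < gridPoint t m (gridIndex (fun i => N (gridPoint t m i) ω) m l) + V l ω ↔
        (t : ℝ) < (arrivalTime N l ω : ℝ) + V l ω) := by
    intro l hl
    rw [Finset.mem_range] at hl
    have hne : {s : ℝ≥0 | l + 1 ≤ N s ω}.Nonempty := ⟨t, hl⟩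
    have hbd : ∀ m : ℕ, m ≠ 0 →
        (gridPoint t m (gridIndex (fun i => N (gridPoint t m i) ω) m l) : ℝ)
          ≤ arrivalTime N l ω ∧ (arrivalTime N l ω : ℝ) ≤
        gridPoint t m (gridIndex (fun i => N (gridPoint t m i) ω) m l) + t / m := by
      intro m hm
      have hn : Monotone fun i => N (gridPoint t m i) ω := hmono.comp (gridPoint_mono t m)
      obtain ⟨i, him, h1, h2⟩ := exists_grid (n := fun i => N (gridPoint t m i) ω)
        (by simp [gridPoint_zero, h0]) (l := l) (m := m) (by simpa [gridPoint_self t hm] using hl)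
      rw [gridIndex_eq hn him h1 h2, ← gridPoint_succ]
      refine ⟨?_, ?_⟩
      · refine NNReal.coe_le_coe.2 (le_csInf hne fun s hs => ?_)
        by_contra hlt
        have h3 : N s ω ≤ N (gridPoint t m i) ω := hmono (not_le.1 hlt).le
        have h4 : l + 1 ≤ N s ω := hs
        have h5 : N (gridPoint t m i) ω ≤ l := h1
        omega
      · exact NNReal.coe_le_coe.2 (csInf_le (OrderBot.bddBelow _) h2)
    by_cases hA : (t : ℝ) < (arrivalTime N l ω : ℝ) + V l ω
    · have hlim : Tendsto (fun m : ℕ => (t : ℝ) / m) atTop (𝓝 0) :=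
        tendsto_const_div_atTop_nhds_zero_nat _
      filter_upwards [hlim.eventually (gt_mem_nhds (sub_pos.2 hA)), eventually_ne_atTop 0]
        with m hm hm0
      have := hbd m hm0
      exact ⟨fun _ => hA, fun _ => by linarith⟩
    · filter_upwards [eventually_ne_atTop 0] with m hm0
      have := hbd m hm0
      exact ⟨fun h => by linarith, fun h => absurd h hA⟩
  filter_upwards [(Finset.eventually_all (Finset.range (N t ω))).2 key] with m hm
  unfold gridNumber numberInSystem
  rw [Finset.filter_congr hm]

end Queue

theorem abs_one_sub_mul_le_one {z K : ℝ} (hz : |z| ≤ 1) (h0 : 0 ≤ K) (h1 : K ≤ 1) :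
    |1 - (1 - z) * K| ≤ 1 := by
  rw [abs_le] at hz ⊢
  constructor <;> nlinarith [mul_nonneg h0 (sub_nonneg.2 hz.2), mul_nonneg h0 (sub_nonneg.2 h1)]

theorem gridIndex_congr {n n' : ℕ → ℕ} {m : ℕ} (h : ∀ i ≤ m, n i = n' i) (l : ℕ) :
    gridIndex n m l = gridIndex n' m l := by
  unfold gridIndex
  rw [Finset.filter_congr fun i hi => by rw [h (i + 1) (Finset.mem_range.1 hi)]]

/-- Riemann sums for a monotone weight `w`, against a bounded density. -/
theorem abs_riemann_sub_le {lam w : ℝ → ℝ} {C : ℝ} (hlam : Measurable lam)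
    (h0 : ∀ s, 0 ≤ lam s) (hC : ∀ s, lam s ≤ C) (hw : Monotone w) (hw0 : ∀ s, 0 ≤ w s)
    (hw1 : ∀ s, w s ≤ 1) (t : ℝ≥0) {m : ℕ} (hm : m ≠ 0) :
    |(∑ i ∈ Finset.range m, w (gridPoint t m i) *
        ∫ s in (gridPoint t m i : ℝ)..(gridPoint t m (i + 1) : ℝ), lam s) -
      ∫ s in (0 : ℝ)..t, lam s * w s| ≤ C * (t / m) := by
  have hC0 : 0 ≤ C := (h0 0).trans (hC 0)
  have hwm : Measurable w := hw.measurable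
  have hint1 : ∀ a b, IntervalIntegrable lam volume a b := fun a b =>
    (intervalIntegrable_const (c := C)).mono_fun hlam.aestronglyMeasurable
      (Eventually.of_forall fun s => by
        simpa [Real.norm_eq_abs, abs_of_nonneg (h0 s)] using (hC s).trans (le_abs_self C))
  have hb : ∀ s, lam s * w s ≤ C := fun s => by nlinarith [h0 s, hC s, hw0 s, hw1 s]
  have hint2 : ∀ a b, IntervalIntegrable (fun s => lam s * w s) volume a b := fun a b =>
    (intervalIntegrable_const (c := C)).mono_fun (hlam.mul hwm).aestronglyMeasurable
      (Eventually.of_forall fun s => by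
        simpa [Real.norm_eq_abs, abs_of_nonneg (h0 s), abs_of_nonneg (hw0 s)] using
          (hb s).trans (le_abs_self C))
  have hsum : ∫ s in (0 : ℝ)..t, lam s * w s = ∑ i ∈ Finset.range m,
      ∫ s in (gridPoint t m i : ℝ)..(gridPoint t m (i + 1) : ℝ), lam s * w s := by
    have h := intervalIntegral.sum_integral_adjacent_intervals
      (a := fun i => (gridPoint t m i : ℝ)) (n := m) fun k _ => hint2 _ _
    rw [h]
    simp only [gridPoint_zero, gridPoint_self t hm, NNReal.coe_zero]
  rw [hsum, ← Finset.sum_sub_distrib]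
  have hterm : ∀ i ∈ Finset.range m, |w (gridPoint t m i) *
        (∫ s in (gridPoint t m i : ℝ)..(gridPoint t m (i + 1) : ℝ), lam s) -
        ∫ s in (gridPoint t m i : ℝ)..(gridPoint t m (i + 1) : ℝ), lam s * w s|
      ≤ (C * (t / m)) * (w (gridPoint t m (i + 1)) - w (gridPoint t m i)) := by
    intro i _
    have hle : (gridPoint t m i : ℝ) ≤ gridPoint t m (i + 1) :=
      NNReal.coe_le_coe.2 (gridPoint_mono t m (Nat.le_succ i))
    rw [← intervalIntegral.integral_const_mul,
      ← intervalIntegral.integral_sub ((hint1 _ _).const_mul _) (hint2 _ _)]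
    have h := intervalIntegral.norm_integral_le_of_norm_le_const
      (f := fun s => w (gridPoint t m i) * lam s - lam s * w s)
      (C := C * (w (gridPoint t m (i + 1)) - w (gridPoint t m i)))
      (a := (gridPoint t m i : ℝ)) (b := (gridPoint t m (i + 1) : ℝ)) ?_
    · rw [Real.norm_eq_abs] at h
      refine h.trans (le_of_eq ?_)
      rw [gridPoint_succ, add_sub_cancel_left, abs_of_nonneg (by positivity)]
      ring
    · intro s hs
      rw [Set.uIoc_of_le hle] at hs
      have h1 := hw hs.1.le
      have h2 := hw hs.2
      have e : w (gridPoint t m i) * lam s - lam s * w s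
        = -(lam s * (w s - w (gridPoint t m i))) := by ring
      rw [e, norm_neg, Real.norm_of_nonneg (mul_nonneg (h0 s) (sub_nonneg.2 h1))]
      exact mul_le_mul (hC s) (by linarith) (sub_nonneg.2 h1) hC0
  -- The error on each interval is `C * (t / m)` times the increment of `w`; by monotonicity these
  -- increments are nonnegative and telescope to at most 1.
  refine (Finset.abs_sum_le_sum_abs _ _).trans ((Finset.sum_le_sum hterm).trans ?_)
  rw [← Finset.mul_sum, Finset.sum_range_sub (fun i => w (gridPoint t m i))]
  refine mul_le_of_le_one_right (by positivity) ?_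
  linarith [hw0 (gridPoint t m 0), hw1 (gridPoint t m m)]

/-! ### The law of the number in system -/

section Queue

variable {Ω : Type*} [MeasurableSpace Ω] {μ : Measure Ω} [IsProbabilityMeasure μ]
  {N : ℝ≥0 → Ω → ℕ} {V : ℕ → Ω → ℝ}

theorem integral_prod_service (hVm : ∀ n, Measurable (V n)) (hVi : iIndepFun V μ)
    (hVd : ∀ n, IdentDistrib (V n) (V 0) μ μ) (t z : ℝ) (c : ℕ → ℝ) (L : ℕ) :
    ∫ ω, ∏ l ∈ Finset.range L, (if t < c l + V l ω then z else 1) ∂μ =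
      ∏ l ∈ Finset.range L, (1 - (1 - z) * tail (V 0) μ (t - c l)) := by
  have hVL : iIndepFun (fun i : Fin L => V i) μ :=
    hVi.precomp (g := fun i : Fin L => (i : ℕ)) Fin.val_injective
  have h := iIndepFun.integral_fun_prod_comp (X := fun i : Fin L => V i) hVL
    (f := fun i y => if t < c i + y then z else 1) (fun i => (hVm i).aemeasurable) fun i =>
      (Measurable.ite (measurableSet_lt measurable_const (measurable_id.const_add _))
        measurable_const measurable_const).aestronglyMeasurable
  simp only [Finset.prod_range]
  rw [h]
  refine Finset.prod_congr rfl fun i _ => ?_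
  have hm : MeasurableSet {ω | t - c i < V i ω} := measurableSet_lt measurable_const (hVm i)
  have e1 : (fun ω => if t < c i + V i ω then z else (1 : ℝ)) =
      fun ω => 1 - (1 - z) * ({ω | t - c i < V i ω}.indicator 1 ω) := by
    funext ω
    by_cases hω : t < c i + V i ω
    · have : ω ∈ {ω | t - c i < V i ω} := by simp only [Set.mem_ofPred_eq]; linarith
      simp [hω, this]
    · have : ω ∉ {ω | t - c i < V i ω} := by simp only [Set.mem_ofPred_eq]; linarith
      simp [hω, this]
  have e2 : tail (V 0) μ (t - c i) = μ.real {ω | t - c i < V i ω} := by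
    have := (hVd i).measure_mem_eq (measurableSet_Ioi (a := t - c i))
    simp only [tail, measureReal_def]
    rw [show {ω | t - c i < V 0 ω} = V 0 ⁻¹' Set.Ioi (t - c i) from rfl, ← this]; rfl
  have hI : Integrable ({ω | t - c i < V i ω}.indicator (1 : Ω → ℝ)) μ :=
    (integrable_const (1 : ℝ)).indicator hm
  rw [e1, e2, integral_sub (integrable_const _) (hI.const_mul _),
    integral_const_mul, integral_indicator_one hm]
  simp

/-- Independence allows `D` to be frozen while `W` is averaged. Countability of its range makes
joint measurability of `F` automatic; for this reason the arrival process is observed only at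
finitely many grid points. -/
theorem integral_of_indepFun_countable {α β : Type*} [MeasurableSpace α] [MeasurableSpace β]
    [Countable α] [MeasurableSingletonClass α] {D : Ω → α} {W : Ω → β} (hD : Measurable D)
    (hW : Measurable W) (hi : IndepFun W D μ) {F : α → β → ℝ} (hF : ∀ a, Measurable (F a))
    {B : ℝ} (hB : ∀ a w, |F a w| ≤ B) :
    ∫ ω, F (D ω) (W ω) ∂μ = ∫ ω, ∫ ω', F (D ω) (W ω') ∂μ ∂μ := by
  have hFm : Measurable fun p : α × β => F p.1 p.2 := measurable_from_prod_countable_right hF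
  have h := hi.symm.map_prod_eq_prod_map_map hD.aemeasurable hW.aemeasurable
  have := Measure.isProbabilityMeasure_map (μ := μ) hD.aemeasurable
  have := Measure.isProbabilityMeasure_map (μ := μ) hW.aemeasurable
  have h1 : ∫ ω, F (D ω) (W ω) ∂μ = ∫ p, F p.1 p.2 ∂(μ.map fun ω => (D ω, W ω)) := by
    rw [integral_map (hD.prodMk hW).aemeasurable hFm.aestronglyMeasurable]
  rw [h1, h, integral_prod _ (Integrable.of_bound hFm.aestronglyMeasurable B
    (Eventually.of_forall fun p => hB _ _)),
    integral_map hD.aemeasurable (measurable_of_countable _).aestronglyMeasurable]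
  refine integral_congr_ae (Eventually.of_forall fun ω => ?_)
  simp only
  rw [integral_map hW.aemeasurable (hF _).aestronglyMeasurable]

/-- `gridNumber` in terms of the counts at the grid points and the service times. -/
noncomputable def gridCount (t : ℝ≥0) (m : ℕ) (n : Fin (m + 1) → ℕ) (v : ℕ → ℝ) : ℕ :=
  ((Finset.range (n (Fin.last m))).filter fun l =>
    (t : ℝ) < gridPoint t m (gridIndex (fun i => n (Fin.ofNat (m + 1) i)) m l) + v l).card

omit [MeasurableSpace Ω] in
theorem gridNumber_eq_gridCount {t : ℝ≥0} {m : ℕ} (hm : m ≠ 0) (ω : Ω) :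
    gridNumber N V t m ω = gridCount t m (fun i => N (gridPoint t m i) ω) fun l => V l ω := by
  unfold gridNumber gridCount
  simp only [Fin.val_last, gridPoint_self t hm]
  congr 1
  refine Finset.filter_congr fun l _ => ?_
  rw [gridIndex_congr (n' := fun i => N (gridPoint t m (Fin.ofNat (m + 1) i : Fin (m + 1))) ω)
    fun i hi => by
      simp only [Fin.val_ofNat, Nat.mod_eq_of_lt (Nat.lt_succ_of_le hi)]]

theorem measurable_gridCount (t : ℝ≥0) (m : ℕ) (n : Fin (m + 1) → ℕ) :
    Measurable (gridCount t m n) := by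
  unfold gridCount
  simp only [Finset.card_filter]
  refine Finset.measurable_fun_sum _ fun l _ => ?_
  exact Measurable.ite (measurableSet_lt measurable_const ((measurable_pi_apply l).const_add _))
    measurable_const measurable_const

theorem measurable_gridNumber (hN : ∀ s, Measurable (N s)) (hV : ∀ n, Measurable (V n))
    (t : ℝ≥0) {m : ℕ} (hm : m ≠ 0) : Measurable (gridNumber N V t m) := by
  have h : Measurable fun p : (Fin (m + 1) → ℕ) × (ℕ → ℝ) => gridCount t m p.1 p.2 :=
    measurable_from_prod_countable_right (measurable_gridCount t m)
  have e : gridNumber N V t m =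
      (fun p : (Fin (m + 1) → ℕ) × (ℕ → ℝ) => gridCount t m p.1 p.2) ∘
        fun ω => (fun i : Fin (m + 1) => N (gridPoint t m i) ω, fun l => V l ω) :=
    funext fun ω => gridNumber_eq_gridCount hm ω
  rw [e]
  exact h.comp ((measurable_pi_lambda _ fun i => hN _).prodMk (measurable_pi_lambda _ hV))

omit [IsProbabilityMeasure μ] in
theorem aemeasurable_numberInSystem (hN : IsCountingProcess N μ) (hV : ∀ n, Measurable (V n))
    (t : ℝ≥0) : AEMeasurable (numberInSystem N V t) μ := by
  refine aemeasurable_of_tendsto_metrizable_ae atTop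
    (f := fun m : ℕ => gridNumber N V t (m + 1))
    (fun m => (measurable_gridNumber hN.measurable hV t m.succ_ne_zero).aemeasurable) ?_
  filter_upwards [hN.zero, hN.monotone] with ω h0 hmono
  exact tendsto_const_nhds.congr' (((tendsto_add_atTop_nat 1).eventually
    (eventually_gridNumber_eq hmono h0)).mono fun m hm => hm.symm)

/-- With the grid counts frozen, `z` to the number present is a product over customers. Averaging a
service time replaces a customer's factor by 1 - (1 - z)K̄, evaluated at the rounded arrival, and
equal factors are then collected. -/
theorem integral_pow_gridNumber (hN : IsCountingProcess N μ) (hVm : ∀ n, Measurable (V n))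
    (hVi : iIndepFun V μ) (hVd : ∀ n, IdentDistrib (V n) (V 0) μ μ)
    (hVN : IndepFun (fun ω n => V n ω) (fun ω s => N s ω) μ)
    (t : ℝ≥0) {m : ℕ} (hm : m ≠ 0) {z : ℝ} (hz : |z| ≤ 1) :
    ∫ ω, z ^ gridNumber N V t m ω ∂μ =
      ∫ ω, ∏ i : Fin m, (1 - (1 - z) * tail (V 0) μ (t - gridPoint t m i)) ^
        (N (gridPoint t m (i + 1)) ω - N (gridPoint t m i) ω) ∂μ := by
  let D : Ω → Fin (m + 1) → ℕ := fun ω i => N (gridPoint t m i) ω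
  let W : Ω → ℕ → ℝ := fun ω l => V l ω
  have hD : Measurable D := measurable_pi_lambda _ fun i => hN.measurable _
  have hW : Measurable W := measurable_pi_lambda _ hVm
  have hsel : Measurable fun (p : ℝ≥0 → ℕ) (i : Fin (m + 1)) => p (gridPoint t m i) :=
    measurable_pi_lambda _ fun i => measurable_pi_apply _
  have hi : IndepFun W D μ := hVN.comp (φ := id) measurable_id hsel
  have h1 : ∫ ω, z ^ gridNumber N V t m ω ∂μ = ∫ ω, z ^ gridCount t m (D ω) (W ω) ∂μ :=
    integral_congr_ae (Eventually.of_forall fun ω => by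
      simp only [gridNumber_eq_gridCount hm ω]; rfl)
  rw [h1, integral_of_indepFun_countable (F := fun n v => z ^ gridCount t m n v) (B := 1) hD hW hi
    (fun n => (measurable_of_countable (fun k : ℕ => z ^ k)).comp (measurable_gridCount t m n))
    (fun n v => by rw [abs_pow]; exact pow_le_one₀ (abs_nonneg _) hz)]
  refine integral_congr_ae ?_
  filter_upwards [hN.zero, hN.monotone] with ω h0 hmono
  have hprod : ∀ ω', z ^ gridCount t m (D ω) (W ω') =
      ∏ l ∈ Finset.range (N t ω), if (t : ℝ) <
        gridPoint t m (gridIndex (fun i => N (gridPoint t m i) ω) m l) + V l ω' then z else 1 := by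
    intro ω'
    have := gridNumber_eq_gridCount (N := N) (V := fun l _ => V l ω') (t := t) hm ω
    rw [show gridCount t m (D ω) (W ω') = gridNumber N (fun l _ => V l ω') t m ω from this.symm,
      gridNumber, Finset.prod_ite, Finset.prod_const, Finset.prod_const_one, mul_one]
  simp only [hprod]
  rw [integral_prod_service hVm hVi hVd (t : ℝ) z
    (fun l => gridPoint t m (gridIndex (fun i => N (gridPoint t m i) ω) m l))]
  have h := prod_gridIndex (n := fun i => N (gridPoint t m i) ω) (hmono.comp (gridPoint_mono t m))
    (by simp [gridPoint_zero, h0]) (fun i => 1 - (1 - z) * tail (V 0) μ (t - gridPoint t m i)) m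
  simp only [gridPoint_self t hm] at h
  rw [h, Finset.prod_range]

/-- The law of the number in system: if the increments of the arrival process are mixed Poisson
with random intensity `lam`, the number in system is mixed Poisson. -/
theorem numberInSystem_law (hN : IsCountingProcess N μ) (hVm : ∀ n, Measurable (V n))
    (hVi : iIndepFun V μ) (hVd : ∀ n, IdentDistrib (V n) (V 0) μ μ)
    (hVN : IndepFun (fun ω n => V n ω) (fun ω s => N s ω) μ)
    {lam : ℝ → Ω → ℝ} (hlam : Measurable fun p : ℝ × Ω => lam p.1 p.2)
    (hlam0 : ∀ s ω, 0 ≤ lam s ω) {C : ℝ} (hlamC : ∀ s ω, lam s ω ≤ C)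
    (hinc : ∀ (m : ℕ) (τ : Fin (m + 1) → ℝ≥0), Monotone τ → ∀ j : Fin m → ℕ,
      μ.real {ω | ∀ i : Fin m, N (τ i.succ) ω = N (τ i.castSucc) ω + j i} =
        ∫ ω, ∏ i : Fin m, poissonWeight
          (∫ s in (τ i.castSucc : ℝ)..(τ i.succ : ℝ), lam s ω) (j i) ∂μ)
    (t : ℝ≥0) (k : ℕ) :
    μ.real {ω | numberInSystem N V t ω = k} =
      ∫ ω, poissonWeight (∫ s in (0 : ℝ)..t, lam s ω * tail (V 0) μ (t - s)) k ∂μ := by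
  set K := tail (V 0) μ with hK
  have hK0 : ∀ s, 0 ≤ K s := tail_nonneg _
  have hK1 : ∀ s, K s ≤ 1 := tail_le_one _
  have hKm : Monotone fun s : ℝ => K (t - s) := fun a b h =>
    tail_antitone (μ := μ) (V 0) (sub_le_sub_left h _)
  have hlamω : ∀ ω, Measurable fun s => lam s ω := fun ω =>
    hlam.comp (measurable_id.prodMk measurable_const)
  let A : Ω → ℝ := fun ω => ∫ s in (0 : ℝ)..t, lam s ω * K (t - s)
  have hAm : Measurable A := by
    have h : Measurable fun p : Ω × ℝ => lam p.2 p.1 * K (t - p.2) :=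
      (hlam.comp measurable_swap).mul (hKm.measurable.comp measurable_snd)
    simp only [A, intervalIntegral.integral_of_le (NNReal.coe_nonneg t)]
    exact (h.stronglyMeasurable.integral_prod_right' (ν := volume.restrict (Set.Ioc 0 (t : ℝ)))).measurable
  have hA0 : ∀ ω, 0 ≤ A ω := fun ω =>
    intervalIntegral.integral_nonneg (NNReal.coe_nonneg t) fun s _ =>
      mul_nonneg (hlam0 s ω) (hK0 _)
  have hQ := aemeasurable_numberInSystem (t := t) hN hVm
  -- the generating function
  have hgen : ∀ z : ℝ, |z| ≤ 1 → ∫ ω, z ^ numberInSystem N V t ω ∂μ =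
      ∫ ω, Real.exp (-((1 - z) * A ω)) ∂μ := by
    intro z hz
    have hz1 : 0 ≤ 1 - z := by linarith [(abs_le.1 hz).2]
    have hstep : ∀ m : ℕ, m ≠ 0 → ∫ ω, z ^ gridNumber N V t m ω ∂μ =
        ∫ ω, Real.exp (-((1 - z) * ∑ i ∈ Finset.range m, K (t - gridPoint t m i) *
          ∫ s in (gridPoint t m i : ℝ)..(gridPoint t m (i + 1) : ℝ), lam s ω)) ∂μ := by
      intro m hm
      rw [integral_pow_gridNumber hN hVm hVi hVd hVN t hm hz]
      let D : Ω → Fin m → ℕ := fun ω i => N (gridPoint t m (i + 1)) ω - N (gridPoint t m i) ω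
      have hD : Measurable D := measurable_pi_lambda _ fun i =>
        (hN.measurable _).sub (hN.measurable _)
      have hmonoL : ∀ i : ℕ, (gridPoint t m i : ℝ) ≤ gridPoint t m (i + 1) := fun i =>
        NNReal.coe_le_coe.2 (gridPoint_mono t m (Nat.le_succ i))
      have hLm : ∀ i : Fin m, Measurable fun ω =>
          ∫ s in (gridPoint t m i : ℝ)..(gridPoint t m (i + 1) : ℝ), lam s ω := by
        intro i
        simp only [intervalIntegral.integral_of_le (hmonoL i)]
        exact ((hlam.comp measurable_swap).stronglyMeasurable.integral_prod_right'
          (ν := volume.restrict (Set.Ioc _ _))).measurable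
      have h := integral_prod_pow_of_mixedPoisson (μ := μ) hD hLm
        (fun i ω => intervalIntegral.integral_nonneg (hmonoL i) fun s _ => hlam0 s ω)
        (fun j => ?_) (a := fun i : Fin m => 1 - (1 - z) * K (t - gridPoint t m i))
        (fun i => abs_one_sub_mul_le_one hz (hK0 _) (hK1 _))
      · refine h.trans (integral_congr_ae (Eventually.of_forall fun ω => ?_))
        simp only
        rw [← Real.exp_sum, Finset.mul_sum, Finset.sum_range, ← Finset.sum_neg_distrib]
        congr 1
        refine Finset.sum_congr rfl fun i _ => ?_
        ring
      · have h := hinc m (fun i => gridPoint t m i) (fun a b h => gridPoint_mono t m h) j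
        simp only [Fin.val_succ, Fin.val_castSucc] at h
        rw [← h]
        refine measureReal_congr ?_
        filter_upwards [hN.monotone] with ω hmono
        refine propext ?_
        change D ω = j ↔ ∀ i : Fin m, N (gridPoint t m (i + 1)) ω = N (gridPoint t m i) ω + j i
        rw [funext_iff]
        refine forall_congr' fun i => ?_
        have : N (gridPoint t m i) ω ≤ N (gridPoint t m (i + 1)) ω :=
          hmono (gridPoint_mono t m (Nat.le_succ i))
        simp only [D]
        omega
    -- The grid is refined on both sides of `hstep`: on the left the integrands are eventually
    -- constant in `m`, on the right Riemann sums converge. The shift to `m + 1` excludes the empty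
    -- grid.
    have hl1 : Tendsto (fun m : ℕ => ∫ ω, z ^ gridNumber N V t (m + 1) ω ∂μ) atTop
        (𝓝 (∫ ω, z ^ numberInSystem N V t ω ∂μ)) := by
      refine tendsto_integral_of_dominated_convergence (fun _ => 1) (fun m => ?_)
        (integrable_const 1) (fun m => Eventually.of_forall fun ω => ?_) ?_
      · exact ((measurable_of_countable (fun k : ℕ => z ^ k)).comp
          (measurable_gridNumber hN.measurable hVm t m.succ_ne_zero)).aestronglyMeasurable
      · rw [norm_pow]; exact pow_le_one₀ (norm_nonneg _) hz
      · filter_upwards [hN.zero, hN.monotone] with ω h0 hmono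
        exact tendsto_const_nhds.congr' (((tendsto_add_atTop_nat 1).eventually
          (eventually_gridNumber_eq (V := V) (t := t) hmono h0)).mono fun m hm => by simp only [hm])
    have hl2 : Tendsto (fun m : ℕ => ∫ ω, z ^ gridNumber N V t (m + 1) ω ∂μ) atTop
        (𝓝 (∫ ω, Real.exp (-((1 - z) * A ω)) ∂μ)) := by
      simp only [fun m : ℕ => hstep (m + 1) m.succ_ne_zero]
      refine tendsto_integral_of_dominated_convergence (fun _ => 1) (fun m => ?_)
        (integrable_const 1) (fun m => Eventually.of_forall fun ω => ?_)
        (Eventually.of_forall fun ω => ?_)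
      · refine Measurable.aestronglyMeasurable (Real.measurable_exp.comp
          (Measurable.neg (Measurable.const_mul (Finset.measurable_fun_sum _ fun i _ => ?_) _)))
        refine Measurable.const_mul ?_ _
        simp only [intervalIntegral.integral_of_le (NNReal.coe_le_coe.2
          (gridPoint_mono t (m + 1) (Nat.le_succ i)))]
        exact ((hlam.comp measurable_swap).stronglyMeasurable.integral_prod_right'
          (ν := volume.restrict (Set.Ioc _ _))).measurable
      · rw [Real.norm_of_nonneg (Real.exp_nonneg _), Real.exp_le_one_iff, neg_nonpos]
        refine mul_nonneg hz1 (Finset.sum_nonneg fun i _ => mul_nonneg (hK0 _) ?_)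
        exact intervalIntegral.integral_nonneg (NNReal.coe_le_coe.2
          (gridPoint_mono t (m + 1) (Nat.le_succ i))) fun s _ => hlam0 s ω
      · refine (Real.continuous_exp.tendsto _).comp (Tendsto.neg (Tendsto.const_mul _ ?_))
        rw [tendsto_iff_norm_sub_tendsto_zero]
        have hlim : Tendsto (fun m : ℕ => C * ((t : ℝ) / ((m + 1 : ℕ) : ℝ))) atTop (𝓝 0) := by
          have := ((tendsto_const_div_atTop_nhds_zero_nat (t : ℝ)).comp
            (tendsto_add_atTop_nat 1)).const_mul C
          simpa using this
        refine squeeze_zero (fun m => norm_nonneg _) (fun m => ?_) hlim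
        exact abs_riemann_sub_le (w := fun s => K (t - s)) (hlamω ω) (fun s => hlam0 s ω)
          (fun s => hlamC s ω) hKm (fun s => hK0 _) (fun s => hK1 _) t m.succ_ne_zero
    exact tendsto_nhds_unique hl1 hl2
  have hC0 : 0 ≤ C := by
    obtain ⟨ω⟩ := nonempty_of_isProbabilityMeasure μ
    exact (hlam0 0 ω).trans (hlamC 0 ω)
  have hAC : ∀ ω, A ω ≤ C * t := fun ω => by
    have := intervalIntegral.norm_integral_le_of_norm_le_const (a := 0) (b := (t : ℝ))
      (f := fun s => lam s ω * K (t - s)) (C := C) fun s _ => by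
        rw [Real.norm_of_nonneg (mul_nonneg (hlam0 s ω) (hK0 _))]
        nlinarith [hlam0 s ω, hlamC s ω, hK0 (t - s), hK1 (t - s)]
    rw [sub_zero, abs_of_nonneg (NNReal.coe_nonneg t)] at this
    exact (le_abs_self _).trans this
  have hmain := eq_of_hasSum_pow (a := fun k => μ.real {ω | numberInSystem N V t ω = k})
    (b := fun k => ∫ ω, poissonWeight (A ω) k ∂μ) (F := fun z =>
      ∫ ω, Real.exp (-((1 - z) * A ω)) ∂μ) ?_ ?_
  · exact congrFun hmain k
  · intro z hz
    rw [← hgen z hz.le]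
    have := Measure.isProbabilityMeasure_map hQ
    have hint : Integrable (fun k : ℕ => z ^ k) (μ.map (numberInSystem N V t)) :=
      Integrable.of_bound (measurable_of_countable _).aestronglyMeasurable 1
        (Eventually.of_forall fun k => by rw [norm_pow]; exact pow_le_one₀ (norm_nonneg _) hz.le)
    have h1 := integral_countable hint
    rw [integral_map hQ (measurable_of_countable _).aestronglyMeasurable] at h1
    have e : ∀ k : ℕ, (μ.map (numberInSystem N V t)).real {k} • z ^ k =
        z ^ k * μ.real {ω | numberInSystem N V t ω = k} := fun k => by
      rw [measureReal_def, Measure.map_apply_of_aemeasurable hQ (measurableSet_singleton k),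
        smul_eq_mul, mul_comm]; rfl
    simp only [e] at h1
    rw [h1]
    refine Summable.hasSum ((summable_geometric_of_abs_lt_one (r := |z|)
      (by rwa [abs_abs])).of_norm_bounded fun k => ?_)
    rw [norm_mul, norm_pow, Real.norm_of_nonneg measureReal_nonneg]
    exact mul_le_of_le_one_right (by positivity) measureReal_le_one
  · intro z hz
    have hpw : ∀ k ω, 0 ≤ poissonWeight (A ω) k := fun k ω => poissonWeight_nonneg (hA0 ω) k
    have h := hasSum_integral_of_dominated_convergence (μ := μ)
      (F := fun k ω => z ^ k * poissonWeight (A ω) k)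
      (f := fun ω => Real.exp (-((1 - z) * A ω)))
      (fun k ω => poissonWeight (A ω) k)
      (fun k => (((continuous_poissonWeight k).measurable.comp hAm).const_mul _).aestronglyMeasurable)
      (fun k => Eventually.of_forall fun ω => ?_)
      (Eventually.of_forall fun ω => by simpa using (hasSum_pow_mul_poissonWeight (A ω) 1).summable)
      ?_ (Eventually.of_forall fun ω => hasSum_pow_mul_poissonWeight (A ω) z)
    · simpa only [integral_const_mul] using h
    · rw [norm_mul, norm_pow, Real.norm_of_nonneg (hpw k ω)]
      exact mul_le_of_le_one_left (hpw k ω) (pow_le_one₀ (norm_nonneg _) hz.le)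
    · have : (fun ω => ∑' k, poissonWeight (A ω) k) = fun _ => 1 := by
        funext ω
        simpa using (hasSum_pow_mul_poissonWeight (A ω) 1).tsum_eq
      rw [this]; exact integrable_const 1

end Queue

/-! ### Integrals adapted to a sub-σ-algebra -/

section Adapted

variable {Ω : Type*} {F mΩ : MeasurableSpace Ω} {μ : Measure Ω} [IsProbabilityMeasure μ]

theorem measurable_intervalIntegral_of_uncurry {ψ : ℝ → Ω → ℝ}
    (hψ : Measurable fun p : ℝ × Ω => ψ p.1 p.2) (a b : ℝ) :
    Measurable fun ω => ∫ s in a..b, ψ s ω := by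
  have h : ∀ a b : ℝ, Measurable fun ω => ∫ s in Set.Ioc a b, ψ s ω := fun a b =>
    ((hψ.comp measurable_swap).stronglyMeasurable.integral_prod_right'
      (ν := volume.restrict (Set.Ioc a b))).measurable
  exact (h a b).sub (h b a)

/-- Fubini for bounded functions on a bounded interval. -/
theorem integral_mul_intervalIntegral {ψ : ℝ → Ω → ℝ}
    (hψ : Measurable fun p : ℝ × Ω => ψ p.1 p.2) {M : ℝ} (hM : ∀ s ω, |ψ s ω| ≤ M)
    {W : Ω → ℝ} (hW : AEStronglyMeasurable W μ) {B : ℝ} (hB : ∀ᵐ ω ∂μ, |W ω| ≤ B)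
    {a b : ℝ} (hab : a ≤ b) :
    ∫ ω, W ω * (∫ s in a..b, ψ s ω) ∂μ = ∫ s in a..b, ∫ ω, W ω * ψ s ω ∂μ := by
  simp only [intervalIntegral.integral_of_le hab, ← integral_const_mul]
  refine integral_integral_swap (f := fun ω s => W ω * ψ s ω) ?_
  have hm : AEStronglyMeasurable (Function.uncurry fun ω s => W ω * ψ s ω)
      (μ.prod (volume.restrict (Set.Ioc a b))) :=
    hW.comp_fst.mul (hψ.comp measurable_swap).aestronglyMeasurable
  refine Integrable.of_bound hm (B * M) ?_
  have h1 : ∀ᵐ p ∂(μ.prod (volume.restrict (Set.Ioc a b))), |W p.1| ≤ B :=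
    Measure.quasiMeasurePreserving_fst.ae hB
  filter_upwards [h1] with p hp
  simp only [Function.uncurry, norm_mul, Real.norm_eq_abs]
  exact mul_le_mul hp (hM _ _) (abs_nonneg _) ((abs_nonneg _).trans hp)

/-- An integral over time of random variables that are measurable for `F` is a.e. measurable for
`F`, even if the integrand is only jointly measurable for the large σ-algebra. -/
theorem aestronglyMeasurable_intervalIntegral (hF : F ≤ mΩ)
    {ψ : ℝ → Ω → ℝ} (hψ : Measurable fun p : ℝ × Ω => ψ p.1 p.2) {M : ℝ}
    (hM : ∀ s ω, |ψ s ω| ≤ M) {a b : ℝ} (hab : a ≤ b)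
    (hψF : ∀ s ∈ Set.Ioc a b, Measurable[F] (ψ s)) :
    AEStronglyMeasurable[F] (fun ω => ∫ s in a..b, ψ s ω) μ := by
  set Z : Ω → ℝ := fun ω => ∫ s in a..b, ψ s ω with hZ
  have hZm : Measurable Z := measurable_intervalIntegral_of_uncurry hψ a b
  have hZb : ∀ ω, |Z ω| ≤ M * |b - a| := fun ω =>
    intervalIntegral.norm_integral_le_of_norm_le_const (f := fun s => ψ s ω) fun s _ => hM s ω
  have hZi : Integrable Z μ := Integrable.of_bound hZm.aestronglyMeasurable (M * |b - a|)
    (Eventually.of_forall hZb)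
  have hae : Z =ᵐ[μ] μ[Z | F] := by
    refine Integrable.ae_eq_of_forall_setIntegral_eq _ _ hZi integrable_condExp fun A hA _ => ?_
    -- `A` is any event of the large σ-algebra. Self-adjointness of conditional expectation moves
    -- the conditioning from `Z` to the indicator; Fubini then reaches the integrand at a fixed
    -- time, where measurability for `F` allows `κ` to be replaced by the indicator again.
    set κ : Ω → ℝ := μ[A.indicator (1 : Ω → ℝ) | F] with hκ
    have hAi : Integrable (A.indicator (1 : Ω → ℝ)) μ := (integrable_const (1 : ℝ)).indicator hA
    have hκm : StronglyMeasurable[F] κ := stronglyMeasurable_condExp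
    have hκb : ∀ᵐ ω ∂μ, |κ ω| ≤ 1 := by
      have := ae_bdd_abs_condExp_of_ae_bdd_abs (m := F) (μ := μ) (R := 1) (f := A.indicator (1 : Ω → ℝ))
        (Eventually.of_forall fun ω => by
          by_cases h : ω ∈ A <;> simp [h])
      simpa using this
    have hpull : ∀ G : Ω → ℝ, StronglyMeasurable[F] G → Integrable G μ →
        ∫ ω, A.indicator (1 : Ω → ℝ) ω * G ω ∂μ = ∫ ω, κ ω * G ω ∂μ := by
      intro G hG hGi
      have hmul : Integrable (A.indicator (1 : Ω → ℝ) * G) μ := by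
        have : A.indicator (1 : Ω → ℝ) * G = A.indicator G := by
          ext ω; by_cases h : ω ∈ A <;> simp [h]
        rw [this]; exact hGi.indicator hA
      have h := condExp_mul_of_aestronglyMeasurable_right (m := F) hG.aestronglyMeasurable hmul hAi
      rw [show (fun ω => A.indicator (1 : Ω → ℝ) ω * G ω) = A.indicator (1 : Ω → ℝ) * G from rfl,
        ← integral_condExp hF, integral_congr_ae h]
      rfl
    have hind : ∀ G : Ω → ℝ, ∫ ω in A, G ω ∂μ = ∫ ω, A.indicator (1 : Ω → ℝ) ω * G ω ∂μ := by
      intro G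
      rw [← integral_indicator hA]
      congr 1
      ext ω; by_cases h : ω ∈ A <;> simp [h]
    rw [hind, hind, hpull _ stronglyMeasurable_condExp integrable_condExp]
    have e1 : ∫ ω, κ ω * (μ[Z | F]) ω ∂μ = ∫ ω, κ ω * Z ω ∂μ := by
      have hmul : Integrable (κ * Z) μ := hZi.bdd_mul
        (integrable_condExp.aestronglyMeasurable) (by simpa using hκb)
      have h := condExp_mul_of_aestronglyMeasurable_left (m := F) hκm.aestronglyMeasurable hmul hZi
      rw [show (fun ω => κ ω * Z ω) = κ * Z from rfl, ← integral_condExp hF (f := κ * Z),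
        integral_congr_ae h]
      rfl
    rw [e1, hZ, integral_mul_intervalIntegral hψ hM hAi.aestronglyMeasurable (B := 1)
      (Eventually.of_forall fun ω => by by_cases h : ω ∈ A <;> simp [h]) hab,
      integral_mul_intervalIntegral hψ hM integrable_condExp.aestronglyMeasurable hκb hab,
      intervalIntegral.integral_of_le hab, intervalIntegral.integral_of_le hab]
    refine setIntegral_congr_fun measurableSet_Ioc fun s hs => ?_
    have hm : Measurable (ψ s) := (hψF s hs).mono hF le_rfl
    exact hpull _ (hψF s hs).stronglyMeasurable
      (Integrable.of_bound hm.aestronglyMeasurable M (Eventually.of_forall (hM s)))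
  exact stronglyMeasurable_condExp.aestronglyMeasurable.congr hae.symm

end Adapted

/-! ### Markov processes -/

/-- `E_y h(X(u))`. -/
noncomputable def expect {S : Type*} [MeasurableSpace S] (P : Kernel (ℝ≥0 × S) S) (h : S → ℝ)
    (u : ℝ≥0) (y : S) : ℝ := ∫ z, h z ∂(P (u, y))

theorem measurable_expect {S : Type*} [MeasurableSpace S] {P : Kernel (ℝ≥0 × S) S}
    {h : S → ℝ} (hh : Measurable h) : Measurable fun p : ℝ≥0 × S => expect P h p.1 p.2 :=
  (hh.stronglyMeasurable.integral_kernel (κ := P)).measurable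

section Markov

variable {S Ω : Type*} [MeasurableSpace S] {mΩ : MeasurableSpace Ω} {μ : Measure Ω}
  {P : Kernel (ℝ≥0 × S) S} {x : S} {X : ℝ≥0 → Ω → S}

theorem IsMarkovProcessFrom.measurable_apply (hX : IsMarkovProcessFrom P x X μ) (s : ℝ≥0) :
    Measurable (X s) := hX.measurable.comp (measurable_const.prodMk measurable_id)

theorem IsMarkovProcessFrom.pathSigma_le (hX : IsMarkovProcessFrom P x X μ) :
    pathSigma X ≤ mΩ := iSup_le fun r => (hX.measurable_apply r).comap_le

theorem IsMarkovProcessFrom.pastSigma_le (hX : IsMarkovProcessFrom P x X μ) (s : ℝ≥0) :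
    pastSigma X s ≤ mΩ := iSup_le fun r => iSup_le fun _ => (hX.measurable_apply r).comap_le

theorem measurable_pastSigma (X : ℝ≥0 → Ω → S) {r s : ℝ≥0} (h : r ≤ s) :
    Measurable[pastSigma X s] (X r) :=
  measurable_iff_comap_le.2 (le_iSup₂_of_le (f := fun r (_ : r ≤ s) =>
    MeasurableSpace.comap (X r) inferInstance) r h le_rfl)

/-- The transition kernel over time `u`. -/
noncomputable def stepKernel (P : Kernel (ℝ≥0 × S) S) (u : ℝ≥0) : Kernel S S :=
  P.comap (fun y => (u, y)) (by fun_prop)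

instance [IsMarkovKernel P] (u : ℝ≥0) : IsMarkovKernel (stepKernel P u) := by
  unfold stepKernel; infer_instance

variable [IsProbabilityMeasure μ] [IsMarkovKernel P]

/-- Integrating the Markov property over a past event gives an identity of measures on the state
space. Composition of kernels then handles integrable test functions directly, without approximation
by indicators. -/
theorem IsMarkovProcessFrom.map_restrict (hX : IsMarkovProcessFrom P x X μ) (s u : ℝ≥0)
    {A : Set Ω} (hA : MeasurableSet[pastSigma X s] A) :
    (μ.restrict A).map (X (s + u)) = (stepKernel P u) ∘ₘ ((μ.restrict A).map (X s)) := by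
  have hA' : MeasurableSet A := hX.pastSigma_le s A hA
  ext B hB
  have hpre : MeasurableSet (X (s + u) ⁻¹' B) := hX.measurable_apply _ hB
  have hkm : Measurable fun y => P (u, y) B :=
    (P.measurable_coe hB).comp (measurable_const.prodMk measurable_id)
  rw [Measure.map_apply (hX.measurable_apply _) hB, Measure.bind_apply hB (Kernel.aemeasurable _)]
  change _ = ∫⁻ y, P (u, y) B ∂((μ.restrict A).map (X s))
  rw [lintegral_map hkm (hX.measurable_apply _)]
  have h1 := setIntegral_condExp (hX.pastSigma_le s)
    (f := (X (s + u) ⁻¹' B).indicator fun _ => (1 : ℝ)) ((integrable_const (μ := μ) (1 : ℝ)).indicator hpre) hA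
  rw [setIntegral_congr_ae hA' ((hX.markov s u B hB).mono fun ω h _ => h),
    integral_indicator hpre, setIntegral_const, smul_eq_mul, mul_one] at h1
  have h2 : ∫⁻ ω in A, P (u, X s ω) B ∂μ = ENNReal.ofReal (∫ ω in A, (P (u, X s ω)).real B ∂μ) := by
    rw [ofReal_integral_eq_lintegral_ofReal]
    · refine lintegral_congr fun ω => ?_
      rw [ofReal_measureReal]
    · refine Integrable.of_bound ?_ 1 (Eventually.of_forall fun ω => ?_)
      · exact ((hkm.comp (hX.measurable_apply s)).ennreal_toReal).aestronglyMeasurable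
      · rw [Real.norm_of_nonneg measureReal_nonneg]; exact measureReal_le_one
    · exact Eventually.of_forall fun ω => measureReal_nonneg
  rw [h2, h1, ofReal_measureReal]

theorem IsMarkovProcessFrom.map_eq (hX : IsMarkovProcessFrom P x X μ) (u : ℝ≥0) :
    μ.map (X u) = P (u, x) := by
  have h := hX.map_restrict 0 u (A := Set.univ) MeasurableSet.univ
  have h0 : μ.map (X 0) = Measure.dirac x := by
    rw [Measure.map_congr (f := X 0) (g := fun _ => x) hX.initial, Measure.map_const, measure_univ,
      one_smul]
  rw [Measure.restrict_univ, zero_add, h0, Measure.dirac_bind (Kernel.measurable _)] at h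
  rw [h]; rfl

/-- The Markov property for integrable functions of the future state. -/
theorem IsMarkovProcessFrom.condExp_eq (hX : IsMarkovProcessFrom P x X μ) (s u : ℝ≥0)
    {h : S → ℝ} (hh : Measurable h) (hi : Integrable (fun ω => h (X (s + u) ω)) μ) :
    μ[fun ω => h (X (s + u) ω) | pastSigma X s] =ᵐ[μ] fun ω => expect P h u (X s ω) := by
  have hu : Measurable fun y => expect P h u y :=
    (measurable_expect hh).comp (measurable_const.prodMk measurable_id)
  have key : ∀ A, MeasurableSet[pastSigma X s] A →
      IntegrableOn (fun ω => expect P h u (X s ω)) A μ ∧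
      ∫ ω in A, expect P h u (X s ω) ∂μ = ∫ ω in A, h (X (s + u) ω) ∂μ := by
    intro A hA
    have hm := hX.map_restrict s u hA
    have hi1 : Integrable h ((μ.restrict A).map (X (s + u))) :=
      (integrable_map_measure hh.aestronglyMeasurable (hX.measurable_apply _).aemeasurable).2
        hi.integrableOn
    rw [hm] at hi1
    have hi2 : Integrable (fun y => expect P h u y) ((μ.restrict A).map (X s)) :=
      ((Measure.integrable_integral_norm_of_integrable_comp hi1).mono hu.aestronglyMeasurable
        (Eventually.of_forall fun y =>
          (norm_integral_le_integral_norm _).trans (le_abs_self _)))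
    refine ⟨(integrable_map_measure hu.aestronglyMeasurable
      (hX.measurable_apply _).aemeasurable).1 hi2, ?_⟩
    rw [← integral_map (φ := X s) (f := fun y => expect P h u y)
      (hX.measurable_apply _).aemeasurable hu.aestronglyMeasurable,
      ← integral_map (φ := X (s + u)) (f := h) (hX.measurable_apply _).aemeasurable
      hh.aestronglyMeasurable, hm]
    rw [Measure.comp_eq_comp_const_apply] at hi1 ⊢
    rw [Kernel.integral_comp hi1, Kernel.const_apply]
    rfl
  refine (ae_eq_condExp_of_forall_setIntegral_eq (hX.pastSigma_le s) hi
    (fun A hA _ => (key A hA).1) (fun A hA _ => (key A hA).2) ?_).symm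
  exact ((hu.comp (measurable_pastSigma X le_rfl)).stronglyMeasurable).aestronglyMeasurable

theorem IsMarkovProcessFrom.integral_mul_eq (hX : IsMarkovProcessFrom P x X μ) (s u : ℝ≥0)
    {h : S → ℝ} (hh : Measurable h) (hi : Integrable (fun ω => h (X (s + u) ω)) μ)
    {W : Ω → ℝ} (hW : AEStronglyMeasurable[pastSigma X s] W μ) {B : ℝ}
    (hB : ∀ᵐ ω ∂μ, |W ω| ≤ B) :
    ∫ ω, W ω * h (X (s + u) ω) ∂μ = ∫ ω, W ω * expect P h u (X s ω) ∂μ := by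
  have hmul : Integrable (W * fun ω => h (X (s + u) ω)) μ :=
    hi.bdd_mul (hW.mono (hX.pastSigma_le s)) (by simpa using hB)
  have h1 := condExp_mul_of_aestronglyMeasurable_left hW hmul hi
  rw [show (fun ω => W ω * h (X (s + u) ω)) = W * fun ω => h (X (s + u) ω) from rfl,
    ← integral_condExp (hX.pastSigma_le s), integral_congr_ae h1]
  refine integral_congr_ae ?_
  filter_upwards [hX.condExp_eq s u hh hi] with ω hω
  simp only [Pi.mul_apply, hω]

end Markov

/-! ### Functionals of a rapidly changing ergodic process -/

/-- The state at time `s` of the process accelerated by the factor `1 / e`. -/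
noncomputable def fastState {S Ω : Type*} (X : ℝ≥0 → Ω → S) (e s : ℝ) (ω : Ω) : S := X (s / e).toNNReal ω

/-- `∫_0^r φ(X(s / e)) w(s) ds`. -/
noncomputable def fluctuation {S Ω : Type*} (φ : S → ℝ) (w : ℝ → ℝ) (X : ℝ≥0 → Ω → S)
    (e r : ℝ) (ω : Ω) : ℝ := ∫ s in (0 : ℝ)..r, φ (fastState X e s ω) * w s

/-- A geometrically ergodic Markov process with explicit constants, together with a bounded
function `φ` of mean zero. -/
structure IsDriver {S Ω : Type*} [MeasurableSpace S] [MeasurableSpace Ω]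
    (P : Kernel (ℝ≥0 × S) S) (v : S → ℝ) (π : Measure S) (x : S) (X : ℝ≥0 → Ω → S)
    (μ : Measure Ω) (φ : S → ℝ) (M d α : ℝ) : Prop where
  markov : IsMarkovProcessFrom P x X μ
  ergodic : IsGeometricallyErgodic P v π
  rate_pos : 0 < α
  const_nonneg : 0 ≤ d
  bound : ∀ h : S → ℝ, Measurable h → (∀ y, |h y| ≤ v y) → ∀ (t : ℝ≥0) (y : S),
    |∫ z, h z ∂(P (t, y)) - ∫ z, h z ∂π| ≤ d * v y * Real.exp (-α * t)
  measurable : Measurable φ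
  bdd_pos : 0 < M
  bdd : ∀ y, |φ y| ≤ M
  mean_zero : ∫ y, φ y ∂π = 0

theorem toNNReal_div_add {e q s : ℝ} (he : 0 < e) (hq : 0 ≤ q) (hs : q ≤ s) :
    (q / e).toNNReal + ((s - q) / e).toNNReal = (s / e).toNNReal := by
  rw [← Real.toNNReal_add (by positivity) (div_nonneg (by linarith) he.le)]
  congr 1; ring

/-- This is the source of every factor `e` below: mixing at rate `α` of the accelerated process
takes a time of order `e / α`, however long the interval. -/
theorem integral_exp_decay_le {α e q r : ℝ} (hα : 0 < α) (he : 0 < e) :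
    ∫ s in q..r, Real.exp (-α * ((s - q) / e)) ≤ e / α := by
  have hderiv : ∀ s ∈ Set.uIcc q r, HasDerivAt
      (fun s => -(e / α) * Real.exp (-α * ((s - q) / e))) (Real.exp (-α * ((s - q) / e))) s := by
    intro s _
    have h1 : HasDerivAt (fun s => -α * ((s - q) / e)) (-α * (1 / e)) s :=
      (((hasDerivAt_id s).sub_const q).div_const e).const_mul (-α)
    have h2 := h1.exp.const_mul (-(e / α))
    have e1 : -(e / α) * (Real.exp (-α * ((s - q) / e)) * (-α * (1 / e))) =
        Real.exp (-α * ((s - q) / e)) := by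
      field_simp
    rwa [e1] at h2
  rw [intervalIntegral.integral_eq_sub_of_hasDerivAt hderiv
    (Continuous.intervalIntegrable (by fun_prop) _ _)]
  have : 0 ≤ e / α * Real.exp (-α * ((r - q) / e)) := by positivity
  simp only [sub_self, zero_div, mul_zero, Real.exp_zero]
  linarith

/-! ### A priori bounds for the fluctuation process -/

namespace IsDriver

variable {S Ω : Type*} [MeasurableSpace S] {mΩ : MeasurableSpace Ω} {μ : Measure Ω}
  {P : Kernel (ℝ≥0 × S) S} {v : S → ℝ} {π : Measure S} {x : S} {X : ℝ≥0 → Ω → S}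
  {φ : S → ℝ} {M d α : ℝ}

theorem weight_nonneg (hD : IsDriver P v π x X μ φ M d α) (y : S) : 0 ≤ v y :=
  zero_le_one.trans (hD.ergodic.one_le y)

theorem abs_expect_sub_le (hD : IsDriver P v π x X μ φ M d α) {h : S → ℝ} (hh : Measurable h)
    {c : ℝ} (hc : 0 < c) (hv : ∀ y, |h y| ≤ c * v y) (u : ℝ≥0) (y : S) :
    |expect P h u y - ∫ z, h z ∂π| ≤ c * (d * v y * Real.exp (-α * u)) := by
  have h1 := hD.bound (fun y => c⁻¹ * h y) (hh.const_mul _) (fun y => by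
    rw [abs_mul, abs_of_pos (inv_pos.2 hc), inv_mul_le_iff₀ hc]; exact hv y) u y
  rw [integral_const_mul, integral_const_mul, ← mul_sub, abs_mul, abs_of_pos (inv_pos.2 hc),
    inv_mul_le_iff₀ hc] at h1
  exact h1

theorem abs_le_mul_weight (hD : IsDriver P v π x X μ φ M d α) (y : S) : |φ y| ≤ M * v y :=
  (hD.bdd y).trans (le_mul_of_one_le_right hD.bdd_pos.le (hD.ergodic.one_le y))

theorem abs_expect_le (hD : IsDriver P v π x X μ φ M d α) (u : ℝ≥0) (y : S) :
    |expect P φ u y| ≤ M * d * v y * Real.exp (-α * u) := by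
  have h := hD.abs_expect_sub_le hD.measurable hD.bdd_pos hD.abs_le_mul_weight u y
  rw [hD.mean_zero, sub_zero] at h
  linarith

theorem abs_expect_le_const [IsMarkovKernel P] (hD : IsDriver P v π x X μ φ M d α) (u : ℝ≥0)
    (y : S) : |expect P φ u y| ≤ M := by
  have h := norm_integral_le_of_norm_le_const (μ := P (u, y)) (f := φ) (C := M)
    (Eventually.of_forall hD.bdd)
  simpa [expect] using h

theorem measurable_fastState (hD : IsDriver P v π x X μ φ M d α) (e : ℝ) :
    Measurable fun p : ℝ × Ω => fastState X e p.1 p.2 :=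
  hD.markov.measurable.comp
    (((measurable_fst.div_const e).real_toNNReal).prodMk measurable_snd)

theorem measurable_integrand (hD : IsDriver P v π x X μ φ M d α) (e : ℝ) {w : ℝ → ℝ}
    (hw : Measurable w) : Measurable fun p : ℝ × Ω => φ (fastState X e p.1 p.2) * w p.1 :=
  (hD.measurable.comp (hD.measurable_fastState e)).mul (hw.comp measurable_fst)

theorem abs_integrand_le (hD : IsDriver P v π x X μ φ M d α) (e : ℝ) {w : ℝ → ℝ}
    (hw1 : ∀ s, |w s| ≤ 1) (s : ℝ) (ω : Ω) : |φ (fastState X e s ω) * w s| ≤ M := by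
  rw [abs_mul]
  exact (mul_le_of_le_one_right (abs_nonneg _) (hw1 s)).trans (hD.bdd _)

theorem abs_fluctuation_sub_le (hD : IsDriver P v π x X μ φ M d α) (e : ℝ) {w : ℝ → ℝ}
    (hw : Measurable w) (hw1 : ∀ s, |w s| ≤ 1) (a b : ℝ) (ω : Ω) :
    |fluctuation φ w X e b ω - fluctuation φ w X e a ω| ≤ M * |b - a| :=
  abs_integral_sub_le ((hD.measurable_integrand e hw).comp (measurable_id.prodMk measurable_const))
    (fun s => hD.abs_integrand_le e hw1 s ω) 0 a b

theorem abs_fluctuation_le (hD : IsDriver P v π x X μ φ M d α) (e : ℝ) {w : ℝ → ℝ}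
    (hw : Measurable w) (hw1 : ∀ s, |w s| ≤ 1) {r : ℝ} (hr : 0 ≤ r) (ω : Ω) :
    |fluctuation φ w X e r ω| ≤ M * r := by
  have h := hD.abs_fluctuation_sub_le e hw hw1 0 r ω
  simpa [fluctuation, abs_of_nonneg hr] using h

theorem fluctuation_sub (hD : IsDriver P v π x X μ φ M d α) (e : ℝ) {w : ℝ → ℝ}
    (hw : Measurable w) (hw1 : ∀ s, |w s| ≤ 1) (a b : ℝ) (ω : Ω) :
    fluctuation φ w X e b ω - fluctuation φ w X e a ω =
      ∫ s in a..b, φ (fastState X e s ω) * w s := by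
  have hi : ∀ a b, IntervalIntegrable (fun s => φ (fastState X e s ω) * w s) volume a b :=
    fun a b => (intervalIntegrable_const (c := M)).mono_fun
      ((hD.measurable_integrand e hw).comp
        (measurable_id.prodMk measurable_const)).aestronglyMeasurable
      (Eventually.of_forall fun s =>
        (hD.abs_integrand_le e hw1 s ω).trans (le_abs_self M))
  exact intervalIntegral.integral_interval_sub_left (hi _ _) (hi _ _)

/-- Joint measurability holds because the process is Lipschitz in time and measurable at each fixed
time. -/
theorem measurable_fluctuation (hD : IsDriver P v π x X μ φ M d α) (e : ℝ) {w : ℝ → ℝ}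
    (hw : Measurable w) (hw1 : ∀ s, |w s| ≤ 1) :
    Measurable fun p : ℝ × Ω => fluctuation φ w X e p.1 p.2 := by
  have h := measurable_uncurry_of_continuous_of_measurable
    (u := fun (r : ℝ) (ω : Ω) => fluctuation φ w X e r ω) (fun ω => ?_)
    (fun r => measurable_intervalIntegral_of_uncurry (hD.measurable_integrand e hw) 0 r)
  · exact h
  · exact (LipschitzWith.of_dist_le_mul (K := M.toNNReal) fun b a => by
      rw [Real.dist_eq, Real.dist_eq, Real.coe_toNNReal _ hD.bdd_pos.le]
      exact hD.abs_fluctuation_sub_le e hw hw1 a b ω).continuous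

variable [IsProbabilityMeasure μ] [IsMarkovKernel P]

theorem integrable_weight (hD : IsDriver P v π x X μ φ M d α) (s : ℝ≥0) :
    Integrable (fun ω => v (X s ω)) μ := by
  have h := hD.ergodic.integrable s x
  rw [← hD.markov.map_eq s] at h
  exact (integrable_map_measure hD.ergodic.measurable.aestronglyMeasurable
    (hD.markov.measurable_apply s).aemeasurable).1 h

/-- The ergodicity bound applied to `v` itself controls the moments of the weight uniformly in time;
all later error estimates end with this constant. -/
theorem integral_weight_le (hD : IsDriver P v π x X μ φ M d α) (s : ℝ≥0) :
    ∫ ω, v (X s ω) ∂μ ≤ ∫ y, v y ∂π + d * v x := by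
  have e1 : ∫ ω, v (X s ω) ∂μ = ∫ y, v y ∂(P (s, x)) := by
    rw [← hD.markov.map_eq s, integral_map (hD.markov.measurable_apply s).aemeasurable
      hD.ergodic.measurable.aestronglyMeasurable]
  have h := hD.bound v hD.ergodic.measurable
    (fun y => (abs_of_nonneg (hD.weight_nonneg y)).le) s x
  have h2 : Real.exp (-α * s) ≤ 1 := Real.exp_le_one_iff.2 (by
    have := mul_nonneg hD.rate_pos.le (NNReal.coe_nonneg s); linarith)
  have h3 : d * v x * Real.exp (-α * s) ≤ d * v x :=
    mul_le_of_le_one_right (mul_nonneg hD.const_nonneg (hD.weight_nonneg x)) h2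
  rw [e1]
  linarith [le_abs_self (∫ y, v y ∂(P (s, x)) - ∫ y, v y ∂π)]

theorem moment_nonneg (hD : IsDriver P v π x X μ φ M d α) : 0 ≤ ∫ y, v y ∂π + d * v x :=
  (integral_nonneg fun ω => hD.weight_nonneg (X 0 ω)).trans (hD.integral_weight_le 0)

theorem integrable_comp (hD : IsDriver P v π x X μ φ M d α) {h : S → ℝ} (hh : Measurable h)
    {c : ℝ} (hv : ∀ y, |h y| ≤ c * v y) (s : ℝ≥0) : Integrable (fun ω => h (X s ω)) μ :=
  ((hD.integrable_weight s).const_mul c).mono'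
    (hh.comp (hD.markov.measurable_apply s)).aestronglyMeasurable
    (Eventually.of_forall fun _ => hv _)

/-- A bounded random variable times a function of the state that is dominated by the weight. -/
theorem abs_integral_mul_le (hD : IsDriver P v π x X μ φ M d α) {W : Ω → ℝ} {B : ℝ}
    (hB : ∀ᵐ ω ∂μ, |W ω| ≤ B) (hB0 : 0 ≤ B) {G : Ω → ℝ} {c : ℝ} (hc : 0 ≤ c) {s : ℝ≥0}
    (hG : ∀ ω, |G ω| ≤ c * v (X s ω)) :
    |∫ ω, W ω * G ω ∂μ| ≤ B * c * (∫ y, v y ∂π + d * v x) := by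
  have h1 : ‖∫ ω, W ω * G ω ∂μ‖ ≤ ∫ ω, B * c * v (X s ω) ∂μ := by
    refine norm_integral_le_of_norm_le ((hD.integrable_weight s).const_mul _) ?_
    filter_upwards [hB] with ω hω
    rw [norm_mul, mul_assoc]
    exact mul_le_mul hω (hG ω) (norm_nonneg _) hB0
  rw [integral_const_mul] at h1
  exact h1.trans (mul_le_mul_of_nonneg_left (hD.integral_weight_le s) (mul_nonneg hB0 hc))

omit [IsMarkovKernel P] in
-- `X` is jointly but not progressively measurable, so adaptedness of the time integral is obtained
-- only up to null sets.
theorem aestronglyMeasurable_fluctuation (hD : IsDriver P v π x X μ φ M d α) {e : ℝ}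
    (he : 0 < e) {w : ℝ → ℝ} (hw : Measurable w) (hw1 : ∀ s, |w s| ≤ 1) {r q : ℝ} (hr : 0 ≤ r)
    (hrq : r ≤ q) :
    AEStronglyMeasurable[pastSigma X (q / e).toNNReal] (fluctuation φ w X e r) μ := by
  refine aestronglyMeasurable_intervalIntegral (hD.markov.pastSigma_le _)
    (hD.measurable_integrand e hw) (fun s ω => hD.abs_integrand_le e hw1 s ω) hr fun s hs => ?_
  refine Measurable.mul_const (hD.measurable.comp (measurable_pastSigma X ?_)) _
  exact Real.toNNReal_le_toNNReal (by gcongr; exact hs.2.trans hrq)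

/-- The Markov property for the increments of the fluctuation process. -/
theorem integral_mul_increment (hD : IsDriver P v π x X μ φ M d α) {e : ℝ} (he : 0 < e)
    {w : ℝ → ℝ} (hw : Measurable w) (hw1 : ∀ s, |w s| ≤ 1) {q r : ℝ} (hq : 0 ≤ q) (hqr : q ≤ r)
    {W : Ω → ℝ} (hW : AEStronglyMeasurable[pastSigma X (q / e).toNNReal] W μ) {B : ℝ}
    (hB : ∀ᵐ ω ∂μ, |W ω| ≤ B) :
    ∫ ω, W ω * (fluctuation φ w X e r ω - fluctuation φ w X e q ω) ∂μ =
      ∫ ω, W ω * (∫ s in q..r,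
        expect P φ ((s - q) / e).toNNReal (fastState X e q ω) * w s) ∂μ := by
  have hW' : AEStronglyMeasurable W μ := hW.mono (hD.markov.pastSigma_le _)
  simp only [hD.fluctuation_sub e hw hw1 q r]
  have hm2 : Measurable fun p : ℝ × Ω =>
      expect P φ ((p.1 - q) / e).toNNReal (fastState X e q p.2) * w p.1 := by
    refine Measurable.mul ?_ (hw.comp measurable_fst)
    refine (measurable_expect hD.measurable).comp (Measurable.prodMk ?_ ?_)
    · exact ((measurable_fst.sub_const q).div_const e).real_toNNReal
    · exact (hD.markov.measurable_apply _).comp measurable_snd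
  rw [integral_mul_intervalIntegral (hD.measurable_integrand e hw)
      (fun s ω => hD.abs_integrand_le e hw1 s ω) hW' hB hqr,
    integral_mul_intervalIntegral (ψ := fun s ω =>
      expect P φ ((s - q) / e).toNNReal (fastState X e q ω) * w s) hm2 (M := M)
      (fun s ω => by
        rw [abs_mul]
        exact (mul_le_of_le_one_right (abs_nonneg _) (hw1 s)).trans
          (hD.abs_expect_le_const _ _)) hW' hB hqr]
  refine intervalIntegral.integral_congr fun s hs => ?_
  rw [Set.uIcc_of_le hqr] at hs
  have h := hD.markov.integral_mul_eq (q / e).toNNReal ((s - q) / e).toNNReal hD.measurable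
    (hD.integrable_comp hD.measurable hD.abs_le_mul_weight _) hW hB
  rw [toNNReal_div_add he hq hs.1] at h
  simp only [← mul_assoc, integral_mul_const]
  exact congrArg (· * w s) h

omit [IsProbabilityMeasure μ] [IsMarkovKernel P] in
-- Since `φ` has mean zero, its conditional expectation decays exponentially, so the conditional
-- drift of the fluctuation process has order `e` uniformly in the length of the interval.
theorem abs_integral_expect_le (hD : IsDriver P v π x X μ φ M d α) {e : ℝ} (he : 0 < e)
    {w : ℝ → ℝ} (hw1 : ∀ s, |w s| ≤ 1) {q r : ℝ} (hqr : q ≤ r) (y : S) :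
    |∫ s in q..r, expect P φ ((s - q) / e).toNNReal y * w s| ≤ M * d * (e / α) * v y := by
  have hMd : 0 ≤ M * d * v y :=
    mul_nonneg (mul_nonneg hD.bdd_pos.le hD.const_nonneg) (hD.weight_nonneg y)
  have h1 : ‖∫ s in q..r, expect P φ ((s - q) / e).toNNReal y * w s‖ ≤
      ∫ s in q..r, M * d * v y * Real.exp (-α * ((s - q) / e)) := by
    refine intervalIntegral.norm_integral_le_of_norm_le hqr (Eventually.of_forall fun s hs => ?_)
      (Continuous.intervalIntegrable (by fun_prop) _ _)
    rw [norm_mul]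
    refine (mul_le_of_le_one_right (norm_nonneg _) (hw1 s)).trans ?_
    have h := hD.abs_expect_le ((s - q) / e).toNNReal y
    rwa [Real.coe_toNNReal _ (div_nonneg (by linarith [hs.1]) he.le)] at h
  rw [intervalIntegral.integral_const_mul] at h1
  refine h1.trans ((mul_le_mul_of_nonneg_left
    (integral_exp_decay_le hD.rate_pos he) hMd).trans (le_of_eq (by ring)))

theorem abs_integral_mul_increment_le (hD : IsDriver P v π x X μ φ M d α) {e : ℝ} (he : 0 < e)
    {w : ℝ → ℝ} (hw : Measurable w) (hw1 : ∀ s, |w s| ≤ 1) {q r : ℝ} (hq : 0 ≤ q) (hqr : q ≤ r)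
    {W : Ω → ℝ} (hW : AEStronglyMeasurable[pastSigma X (q / e).toNNReal] W μ) {B : ℝ}
    (hB : ∀ᵐ ω ∂μ, |W ω| ≤ B) (hB0 : 0 ≤ B) :
    |∫ ω, W ω * (fluctuation φ w X e r ω - fluctuation φ w X e q ω) ∂μ| ≤
      B * (M * d * (e / α)) * (∫ y, v y ∂π + d * v x) := by
  rw [hD.integral_mul_increment he hw hw1 hq hqr hW hB]
  refine hD.abs_integral_mul_le (s := (q / e).toNNReal) hB hB0 ?_
    fun _ => hD.abs_integral_expect_le he hw1 hqr _
  exact mul_nonneg (mul_nonneg hD.bdd_pos.le hD.const_nonneg) (div_nonneg he.le hD.rate_pos.le)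

omit [IsMarkovKernel P] in
/-- The expected Taylor expansion of a smooth function of the fluctuation process. -/
theorem integral_taylor (hD : IsDriver P v π x X μ φ M d α) (e : ℝ)
    {w : ℝ → ℝ} (hw : Measurable w) (hw1 : ∀ s, |w s| ≤ 1) {r : ℝ} (hr : 0 ≤ r)
    {ψ ψ' ψ'' : ℝ → ℝ} (hψ : ∀ y, HasDerivAt ψ (ψ' y) y) (hψ' : ∀ y, HasDerivAt ψ' (ψ'' y) y)
    (hc : Continuous ψ'') :
    ∫ ω, ψ (fluctuation φ w X e r ω) ∂μ = ψ 0 + ψ' 0 * (∫ ω, fluctuation φ w X e r ω ∂μ) +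
      ∫ q in (0 : ℝ)..r, ∫ ω, ψ'' (fluctuation φ w X e q ω) * (φ (fastState X e q ω) * w q) *
        (fluctuation φ w X e r ω - fluctuation φ w X e q ω) ∂μ := by
  have hYm := hD.measurable_fluctuation e hw hw1
  have hYr : Measurable fun ω => fluctuation φ w X e r ω :=
    hYm.comp (measurable_const.prodMk measurable_id)
  have hYb : ∀ q ∈ Set.Icc 0 r, ∀ ω, fluctuation φ w X e q ω ∈ Set.Icc (-(M * r)) (M * r) :=
    fun q hq ω => abs_le.1 ((hD.abs_fluctuation_le e hw hw1 hq.1 ω).trans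
      (mul_le_mul_of_nonneg_left hq.2 hD.bdd_pos.le))
  obtain ⟨B, hB⟩ := (isCompact_Icc (a := -(M * r)) (b := M * r)).exists_bound_of_continuousOn
    hc.continuousOn
  have hYi : Integrable (fun ω => fluctuation φ w X e r ω) μ :=
    Integrable.of_bound hYr.aestronglyMeasurable (M * r)
      (Eventually.of_forall fun ω => hD.abs_fluctuation_le e hw hw1 hr ω)
  have hm : Measurable fun p : ℝ × Ω => ψ'' (fluctuation φ w X e p.1 p.2) *
      (φ (fastState X e p.1 p.2) * w p.1) *
        (fluctuation φ w X e r p.2 - fluctuation φ w X e p.1 p.2) :=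
    ((hc.measurable.comp hYm).mul (hD.measurable_integrand e hw)).mul
      ((hYr.comp measurable_snd).sub hYm)
  have hint : Integrable (Function.uncurry fun (ω : Ω) (q : ℝ) =>
      ψ'' (fluctuation φ w X e q ω) * (φ (fastState X e q ω) * w q) *
        (fluctuation φ w X e r ω - fluctuation φ w X e q ω))
      (μ.prod (volume.restrict (Set.Ioc 0 r))) := by
    refine Integrable.of_bound (hm.comp measurable_swap).aestronglyMeasurable
      (B * M * (M * r)) ?_
    have h1 : ∀ᵐ q ∂(volume.restrict (Set.Ioc (0 : ℝ) r)), q ∈ Set.Ioc (0 : ℝ) r :=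
      ae_restrict_mem measurableSet_Ioc
    have h2 : ∀ᵐ p ∂(μ.prod (volume.restrict (Set.Ioc (0 : ℝ) r))), p.2 ∈ Set.Ioc (0 : ℝ) r :=
      Measure.quasiMeasurePreserving_snd.ae h1
    filter_upwards [h2] with p hp
    have b1 := hB _ (hYb p.2 ⟨hp.1.le, hp.2⟩ p.1)
    have b2 := hD.abs_integrand_le e hw1 p.2 p.1
    have b3 : |fluctuation φ w X e r p.1 - fluctuation φ w X e p.2 p.1| ≤ M * r := by
      refine (hD.abs_fluctuation_sub_le e hw hw1 p.2 r p.1).trans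
        (mul_le_mul_of_nonneg_left ?_ hD.bdd_pos.le)
      rw [abs_of_nonneg (by linarith [hp.2])]
      linarith [hp.1]
    have hB0 : 0 ≤ B := (norm_nonneg _).trans b1
    simp only [Function.uncurry, norm_mul]
    rw [← norm_mul (φ _)]
    exact mul_le_mul (mul_le_mul b1 b2 (norm_nonneg _) hB0) b3 (norm_nonneg _)
      (mul_nonneg hB0 hD.bdd_pos.le)
  have hpt : ∀ ω, ψ (fluctuation φ w X e r ω) = ψ 0 + ψ' 0 * fluctuation φ w X e r ω +
      ∫ q in Set.Ioc 0 r, ψ'' (fluctuation φ w X e q ω) * (φ (fastState X e q ω) * w q) *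
        (fluctuation φ w X e r ω - fluctuation φ w X e q ω) := fun ω => by
    rw [← intervalIntegral.integral_of_le hr]
    exact taylor_primitive hr hψ hψ' hc
      ((hD.measurable_integrand e hw).comp (measurable_id.prodMk measurable_const))
      (fun s => hD.abs_integrand_le e hw1 s ω)
  rw [intervalIntegral.integral_of_le hr, ← integral_integral_swap hint]
  simp only [hpt]
  have i1 : Integrable (fun ω => ψ 0 + ψ' 0 * fluctuation φ w X e r ω) μ :=
    (integrable_const _).add (hYi.const_mul _)
  have i2 := hint.integral_prod_left
  simp only [Function.uncurry] at i2
  rw [integral_add i1 i2, integral_add (integrable_const _) (hYi.const_mul _), integral_const_mul]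
  simp

/-- For y² the Taylor formula has only its remainder, which pairs a bounded past variable with a
future increment at each time. Each such expectation has order `e`. -/
theorem integral_sq_fluctuation_le (hD : IsDriver P v π x X μ φ M d α) {e : ℝ} (he : 0 < e)
    {w : ℝ → ℝ} (hw : Measurable w) (hw1 : ∀ s, |w s| ≤ 1) {r : ℝ} (hr : 0 ≤ r) :
    ∫ ω, fluctuation φ w X e r ω ^ 2 ∂μ ≤
      2 * M * (M * d * (e / α)) * (∫ y, v y ∂π + d * v x) * r := by
  have h := hD.integral_taylor (r := r) e hw hw1 hr (ψ := fun y => y ^ 2) (ψ' := fun y => 2 * y)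
    (ψ'' := fun _ => 2) (fun y => by simpa using hasDerivAt_pow 2 y)
    (fun y => by simpa using (hasDerivAt_id y).const_mul 2) continuous_const
  rw [h]
  simp only [ne_eq, OfNat.ofNat_ne_zero, not_false_eq_true, zero_pow, mul_zero, zero_mul, zero_add]
  have hb : ∀ q ∈ Set.uIoc 0 r, ‖∫ ω, 2 * (φ (fastState X e q ω) * w q) *
      (fluctuation φ w X e r ω - fluctuation φ w X e q ω) ∂μ‖ ≤
      2 * M * (M * d * (e / α)) * (∫ y, v y ∂π + d * v x) := by
    intro q hq
    rw [Set.uIoc_of_le hr] at hq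
    refine hD.abs_integral_mul_increment_le he hw hw1 hq.1.le hq.2 ?_
      (Eventually.of_forall fun ω => ?_) (by linarith [hD.bdd_pos])
    · refine Measurable.aestronglyMeasurable (Measurable.const_mul (Measurable.mul_const ?_ _) _)
      exact hD.measurable.comp (measurable_pastSigma X le_rfl)
    · rw [abs_mul, abs_two]
      exact mul_le_mul_of_nonneg_left (hD.abs_integrand_le e hw1 q ω) zero_le_two
  have := intervalIntegral.norm_integral_le_of_norm_le_const hb
  rw [sub_zero, abs_of_nonneg hr] at this
  exact (le_abs_self _).trans this

theorem integral_abs_fluctuation_le (hD : IsDriver P v π x X μ φ M d α) {e : ℝ} (he : 0 < e)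
    {w : ℝ → ℝ} (hw : Measurable w) (hw1 : ∀ s, |w s| ≤ 1) {r : ℝ} (hr : 0 ≤ r) :
    ∫ ω, |fluctuation φ w X e r ω| ∂μ ≤
      √e * (1 + 2 * M * (M * d * (1 / α)) * (∫ y, v y ∂π + d * v x) * r) := by
  have hYr : Measurable fun ω => fluctuation φ w X e r ω :=
    (hD.measurable_fluctuation e hw hw1).comp (measurable_const.prodMk measurable_id)
  have hs : 0 < √e := Real.sqrt_pos.2 he
  have hsq : √e * √e = e := Real.mul_self_sqrt he.le
  have hi2 : Integrable (fun ω => fluctuation φ w X e r ω ^ 2) μ := by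
    refine Integrable.of_bound (hYr.pow_const 2).aestronglyMeasurable ((M * r) ^ 2)
      (Eventually.of_forall fun ω => ?_)
    rw [norm_pow]
    exact pow_le_pow_left₀ (norm_nonneg _) (hD.abs_fluctuation_le e hw hw1 hr ω) 2
  -- With a second moment of order `e`, the inequality |y| ≤ √e + y²/√e makes both terms of order
  -- √e.
  have h1 : ∫ ω, |fluctuation φ w X e r ω| ∂μ ≤
      ∫ ω, (√e + (√e)⁻¹ * fluctuation φ w X e r ω ^ 2) ∂μ := by
    refine integral_mono_of_nonneg (Eventually.of_forall fun ω => abs_nonneg _)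
      ((integrable_const _).add (hi2.const_mul _)) (Eventually.of_forall fun ω => ?_)
    simp only
    set y := fluctuation φ w X e r ω
    rw [← sq_abs y, ← sub_nonneg]
    have : √e + (√e)⁻¹ * |y| ^ 2 - |y| = (√e)⁻¹ * ((√e - |y| / 2) ^ 2 + 3 / 4 * |y| ^ 2) := by
      field_simp; ring
    rw [this]; positivity
  rw [integral_add (integrable_const _) (hi2.const_mul _), integral_const_mul] at h1
  simp only [integral_const, probReal_univ, smul_eq_mul, one_mul] at h1
  have h2 := mul_le_mul_of_nonneg_left (hD.integral_sq_fluctuation_le he hw hw1 hr)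
    (inv_nonneg.2 hs.le)
  refine h1.trans ((add_le_add le_rfl h2).trans (le_of_eq ?_))
  have : e / α = √e * √e * (1 / α) := by rw [hsq]; ring
  rw [this]
  field_simp

end IsDriver

/-! ### Exact first-order behaviour of increments, and mixing -/

/-- `∫_0^∞ E_y φ(X(u)) du`. -/
noncomputable def green {S : Type*} [MeasurableSpace S] (P : Kernel (ℝ≥0 × S) S) (φ : S → ℝ)
    (y : S) : ℝ := ∫ u in Set.Ioi (0 : ℝ), expect P φ u.toNNReal y

/-- The weighted distance between `w(r)` and `w` on a time scale of order `e` after `r`. -/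
noncomputable def weightModulus (α : ℝ) (w : ℝ → ℝ) (t e r : ℝ) : ℝ :=
  ∫ u in Set.Ioi (0 : ℝ), Real.exp (-α * u) *
    |(Set.Iic ((t - r) / e)).indicator (fun u => w (r + e * u)) u - w r|

theorem measurable_weightModulus_integrand {w : ℝ → ℝ} (hw : Measurable w) (α t e r : ℝ) :
    Measurable fun u => Real.exp (-α * u) *
      |(Set.Iic ((t - r) / e)).indicator (fun u => w (r + e * u)) u - w r| := by
  have h : Measurable ((Set.Iic ((t - r) / e)).indicator fun u => w (r + e * u)) :=
    (hw.comp (by fun_prop)).indicator measurableSet_Iic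
  have h2 : Measurable fun u : ℝ => Real.exp (-α * u) := by fun_prop
  simp only [← Real.norm_eq_abs]
  exact h2.mul (h.sub_const _).norm

theorem weightModulus_integrand_le {w : ℝ → ℝ} (hw1 : ∀ s, |w s| ≤ 1) (α t e r u : ℝ) :
    ‖Real.exp (-α * u) * |(Set.Iic ((t - r) / e)).indicator (fun u => w (r + e * u)) u - w r|‖ ≤
      2 * Real.exp (-α * u) := by
  have h : |(Set.Iic ((t - r) / e)).indicator (fun u => w (r + e * u)) u| ≤ 1 := by
    by_cases hu : u ∈ Set.Iic ((t - r) / e)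
    · simpa only [Set.indicator_of_mem hu] using hw1 _
    · simp [Set.indicator_of_notMem hu]
  rw [norm_mul, Real.norm_of_nonneg (Real.exp_nonneg _), Real.norm_of_nonneg (abs_nonneg _),
    mul_comm]
  exact mul_le_mul_of_nonneg_right ((abs_sub _ _).trans (by linarith [hw1 r])) (Real.exp_nonneg _)

theorem integrableOn_exp_decay {α : ℝ} (hα : 0 < α) :
    IntegrableOn (fun u => Real.exp (-α * u)) (Set.Ioi 0) volume :=
  integrableOn_exp_mul_Ioi (neg_lt_zero.2 hα) 0

theorem integral_exp_decay {α : ℝ} (hα : 0 < α) :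
    ∫ u in Set.Ioi (0 : ℝ), Real.exp (-α * u) = 1 / α := by
  rw [integral_exp_mul_Ioi (neg_lt_zero.2 hα)]
  simp

theorem integrableOn_weightModulus {w : ℝ → ℝ} (hw : Measurable w) (hw1 : ∀ s, |w s| ≤ 1)
    {α : ℝ} (hα : 0 < α) (t e r : ℝ) :
    IntegrableOn (fun u => Real.exp (-α * u) *
      |(Set.Iic ((t - r) / e)).indicator (fun u => w (r + e * u)) u - w r|) (Set.Ioi 0) volume :=
  ((integrableOn_exp_decay hα).const_mul 2).mono'
    (measurable_weightModulus_integrand hw α t e r).aestronglyMeasurable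
    (Eventually.of_forall fun u => weightModulus_integrand_le hw1 α t e r u)

theorem weightModulus_nonneg (α : ℝ) (w : ℝ → ℝ) (t e r : ℝ) : 0 ≤ weightModulus α w t e r :=
  integral_nonneg fun _ => mul_nonneg (Real.exp_nonneg _) (abs_nonneg _)

/-- Dominated convergence: w(r + e u) tends to w(r), and the cutoff (t - r)/e moves to infinity. The
latter needs `r < t`; at `r = t` the modulus equals |w t| / α for every positive `e`. -/
theorem tendsto_weightModulus {w : ℝ → ℝ} (hw : Continuous w) (hw1 : ∀ s, |w s| ≤ 1)
    {α : ℝ} (hα : 0 < α) {t r : ℝ} (hr : r < t) :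
    Tendsto (fun e => weightModulus α w t e r) (𝓝[>] 0) (𝓝 0) := by
  have h := tendsto_integral_filter_of_dominated_convergence
    (μ := volume.restrict (Set.Ioi (0 : ℝ))) (l := 𝓝[>] (0 : ℝ))
    (F := fun e u => Real.exp (-α * u) *
      |(Set.Iic ((t - r) / e)).indicator (fun u => w (r + e * u)) u - w r|)
    (f := fun _ => (0 : ℝ)) (fun u => 2 * Real.exp (-α * u))
    (Eventually.of_forall fun e =>
      (measurable_weightModulus_integrand hw.measurable α t e r).aestronglyMeasurable)
    (Eventually.of_forall fun e => Eventually.of_forall fun u =>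
      weightModulus_integrand_le hw1 α t e r u)
    ((integrableOn_exp_decay hα).const_mul 2) ?_
  · simpa [weightModulus] using h
  · refine Eventually.of_forall fun u => ?_
    have h1 : Tendsto (fun e : ℝ => Real.exp (-α * u) * |w (r + e * u) - w r|) (𝓝[>] 0)
        (𝓝 (Real.exp (-α * u) * |w (r + 0 * u) - w r|)) :=
      (Continuous.tendsto (by fun_prop) 0).mono_left nhdsWithin_le_nhds
    rw [zero_mul, add_zero, sub_self, abs_zero, mul_zero] at h1
    refine h1.congr' ?_
    have h2 : Tendsto (fun e : ℝ => (t - r) / e) (𝓝[>] 0) atTop :=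
      Tendsto.const_mul_atTop (sub_pos.2 hr) tendsto_inv_nhdsGT_zero
    filter_upwards [h2.eventually (eventually_ge_atTop u)] with e he
    rw [Set.indicator_of_mem (show u ∈ Set.Iic ((t - r) / e) from he)]

namespace IsDriver

variable {S Ω : Type*} [MeasurableSpace S] {mΩ : MeasurableSpace Ω} {μ : Measure Ω}
  {P : Kernel (ℝ≥0 × S) S} {v : S → ℝ} {π : Measure S} {x : S} {X : ℝ≥0 → Ω → S}
  {φ : S → ℝ} {M d α : ℝ}

theorem green_constant_nonneg (hD : IsDriver P v π x X μ φ M d α) : 0 ≤ M * d :=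
  mul_nonneg hD.bdd_pos.le hD.const_nonneg

theorem abs_expect_toNNReal_le (hD : IsDriver P v π x X μ φ M d α) {u : ℝ} (hu : 0 < u) (y : S) :
    ‖expect P φ u.toNNReal y‖ ≤ M * d * v y * Real.exp (-α * u) := by
  have h := hD.abs_expect_le u.toNNReal y
  rwa [Real.coe_toNNReal _ hu.le] at h

theorem measurable_expect_toNNReal (hD : IsDriver P v π x X μ φ M d α) :
    Measurable fun p : S × ℝ => expect P φ p.2.toNNReal p.1 :=
  (measurable_expect hD.measurable).comp (measurable_snd.real_toNNReal.prodMk measurable_fst)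

theorem integrableOn_expect (hD : IsDriver P v π x X μ φ M d α) (y : S) :
    IntegrableOn (fun u : ℝ => expect P φ u.toNNReal y) (Set.Ioi 0) volume := by
  refine ((integrableOn_exp_decay hD.rate_pos).const_mul (M * d * v y)).mono'
    (hD.measurable_expect_toNNReal.comp
      (measurable_const.prodMk measurable_id)).aestronglyMeasurable ?_
  exact (ae_restrict_iff' measurableSet_Ioi).2
    (Eventually.of_forall fun u hu => hD.abs_expect_toNNReal_le hu y)

theorem abs_green_le (hD : IsDriver P v π x X μ φ M d α) (y : S) :
    |green P φ y| ≤ M * d * (1 / α) * v y := by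
  have h := norm_integral_le_of_norm_le ((integrableOn_exp_decay hD.rate_pos).const_mul
    (M * d * v y)) ((ae_restrict_iff' measurableSet_Ioi).2
    (Eventually.of_forall fun u hu => hD.abs_expect_toNNReal_le hu y))
  rw [integral_const_mul, integral_exp_decay hD.rate_pos] at h
  exact h.trans (le_of_eq (by ring))

theorem measurable_green (hD : IsDriver P v π x X μ φ M d α) : Measurable (green P φ) :=
  (hD.measurable_expect_toNNReal.stronglyMeasurable.integral_prod_right'
    (ν := volume.restrict (Set.Ioi (0 : ℝ)))).measurable

/-- The substitution s = r + e u turns the drift into `e` times the integral defining `green`, with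
weight w(r + e u) cut off at (t - r)/e. Replacing this weight by w(r) costs both the variation of
`w` and the missing tail; `weightModulus` measures the two together. -/
theorem abs_integral_expect_sub_green_le (hD : IsDriver P v π x X μ φ M d α) {e : ℝ} (he : 0 < e)
    {w : ℝ → ℝ} (hw : Measurable w) (hw1 : ∀ s, |w s| ≤ 1) {r t : ℝ} (hrt : r ≤ t) (y : S) :
    |(∫ s in r..t, expect P φ ((s - r) / e).toNNReal y * w s) - e * (w r * green P φ y)| ≤
      e * (M * d * weightModulus α w t e r) * v y := by
  set T := (t - r) / e with hT
  have hT0 : 0 ≤ T := div_nonneg (sub_nonneg.2 hrt) he.le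
  have hsub : ∫ s in r..t, expect P φ ((s - r) / e).toNNReal y * w s =
      e * ∫ u in Set.Ioi (0 : ℝ), expect P φ u.toNNReal y *
        (Set.Iic T).indicator (fun u => w (r + e * u)) u := by
    have h := intervalIntegral.integral_comp_add_mul (a := 0) (b := T)
      (fun s => expect P φ ((s - r) / e).toNNReal y * w s) he.ne' r
    rw [mul_zero, add_zero, hT, mul_div_cancel₀ _ he.ne', add_sub_cancel, ← hT] at h
    have h2 : ∀ u, expect P φ ((r + e * u - r) / e).toNNReal y = expect P φ u.toNNReal y :=
      fun u => by rw [add_sub_cancel_left, mul_div_cancel_left₀ _ he.ne']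
    simp only [h2] at h
    have h3 : (fun u => expect P φ (Real.toNNReal u) y *
        (Set.Iic T).indicator (fun u => w (r + e * u)) u) =
        (Set.Iic T).indicator fun u => expect P φ u.toNNReal y * w (r + e * u) := by
      funext u; by_cases hu : u ∈ Set.Iic T <;> simp [hu]
    rw [h3, setIntegral_indicator measurableSet_Iic, Set.Ioi_inter_Iic,
      ← intervalIntegral.integral_of_le hT0, h, smul_eq_mul, mul_inv_cancel_left₀ he.ne']
  have hi := hD.integrableOn_expect y
  have hi1 : IntegrableOn (fun u : ℝ => expect P φ u.toNNReal y *
      (Set.Iic T).indicator (fun u => w (r + e * u)) u) (Set.Ioi 0) volume := by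
    refine hi.mul_bdd (c := 1) (Measurable.aestronglyMeasurable
      ((hw.comp (by fun_prop)).indicator measurableSet_Iic)) (Eventually.of_forall fun u => ?_)
    by_cases hu : u ∈ Set.Iic T
    · simpa only [Set.indicator_of_mem hu, Real.norm_eq_abs] using hw1 _
    · simp [Set.indicator_of_notMem hu]
  have hi2 : IntegrableOn (fun u : ℝ => expect P φ u.toNNReal y * w r) (Set.Ioi 0) volume :=
    hi.mul_const _
  have hg : w r * green P φ y = ∫ u in Set.Ioi (0 : ℝ), expect P φ u.toNNReal y * w r := by
    rw [integral_mul_const, mul_comm]; rfl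
  rw [hsub, hg, ← mul_sub, ← integral_sub hi1 hi2, abs_mul, abs_of_pos he, mul_assoc]
  refine mul_le_mul_of_nonneg_left ?_ he.le
  have h := norm_integral_le_of_norm_le
    ((integrableOn_weightModulus hw hw1 hD.rate_pos t e r).const_mul (M * d * v y))
    (f := fun u : ℝ => expect P φ u.toNNReal y *
      (Set.Iic T).indicator (fun u => w (r + e * u)) u - expect P φ u.toNNReal y * w r)
    ((ae_restrict_iff' measurableSet_Ioi).2 (Eventually.of_forall fun u hu => by
      rw [← mul_sub, norm_mul, ← mul_assoc]
      exact mul_le_mul_of_nonneg_right (hD.abs_expect_toNNReal_le hu y) (abs_nonneg _)))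
  rw [integral_const_mul] at h
  exact h.trans (le_of_eq (by rw [weightModulus]; ring))

variable [IsProbabilityMeasure μ] [IsMarkovKernel P]

/-- An increment of the fluctuation process, on the scale `e`, against a past variable. -/
theorem abs_integral_increment_sub_green_le (hD : IsDriver P v π x X μ φ M d α) {e : ℝ}
    (he : 0 < e) {w : ℝ → ℝ} (hw : Measurable w) (hw1 : ∀ s, |w s| ≤ 1) {r t : ℝ} (hr : 0 ≤ r)
    (hrt : r ≤ t) {W : Ω → ℝ} (hW : AEStronglyMeasurable[pastSigma X (r / e).toNNReal] W μ)
    {B : ℝ} (hB : ∀ᵐ ω ∂μ, |W ω| ≤ B) (hB0 : 0 ≤ B) :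
    |(∫ ω, W ω * (fluctuation φ w X e t ω - fluctuation φ w X e r ω) ∂μ) / e -
        w r * ∫ ω, W ω * green P φ (fastState X e r ω) ∂μ| ≤
      B * (M * d * weightModulus α w t e r) * (∫ y, v y ∂π + d * v x) := by
  rw [hD.integral_mul_increment he hw hw1 hr hrt hW hB]
  have hXm : Measurable (fastState X e r) := hD.markov.measurable_apply _
  have hG : Measurable fun ω => ∫ s in r..t,
      expect P φ ((s - r) / e).toNNReal (fastState X e r ω) * w s := by
    refine measurable_intervalIntegral_of_uncurry (ψ := fun s ω =>
      expect P φ ((s - r) / e).toNNReal (fastState X e r ω) * w s) ?_ r t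
    refine Measurable.mul ?_ (hw.comp measurable_fst)
    refine (measurable_expect hD.measurable).comp (Measurable.prodMk ?_ ?_)
    · exact ((measurable_fst.sub_const r).div_const e).real_toNNReal
    · exact hXm.comp measurable_snd
  have hW' : AEStronglyMeasurable W μ := hW.mono (hD.markov.pastSigma_le _)
  have hi1 : Integrable (fun ω => W ω * ∫ s in r..t,
      expect P φ ((s - r) / e).toNNReal (fastState X e r ω) * w s) μ := by
    refine Integrable.bdd_mul ?_ hW' (by simpa using hB)
    exact ((hD.integrable_weight (r / e).toNNReal).const_mul (M * d * (e / α))).mono'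
      hG.aestronglyMeasurable
      (Eventually.of_forall fun _ => hD.abs_integral_expect_le he hw1 hrt _)
  have hi2 : Integrable (fun ω => W ω * green P φ (fastState X e r ω)) μ :=
    Integrable.bdd_mul (hD.integrable_comp hD.measurable_green hD.abs_green_le _) hW'
      (by simpa using hB)
  have hmain := hD.abs_integral_mul_le (W := W) (s := (r / e).toNNReal) (B := B)
    (c := e * (M * d * weightModulus α w t e r))
    (G := fun ω => (∫ s in r..t, expect P φ ((s - r) / e).toNNReal (fastState X e r ω) * w s) -
      e * (w r * green P φ (fastState X e r ω))) hB hB0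
    (mul_nonneg he.le (mul_nonneg hD.green_constant_nonneg (weightModulus_nonneg _ _ _ _ _)))
    (fun _ => hD.abs_integral_expect_sub_green_le he hw hw1 hrt _)
  have e1 : ∀ ω, W ω * ((∫ s in r..t,
      expect P φ ((s - r) / e).toNNReal (fastState X e r ω) * w s) -
      e * (w r * green P φ (fastState X e r ω))) =
      W ω * (∫ s in r..t, expect P φ ((s - r) / e).toNNReal (fastState X e r ω) * w s) -
        (e * w r) * (W ω * green P φ (fastState X e r ω)) := fun ω => by ring
  simp only [e1] at hmain
  rw [integral_sub hi1 (hi2.const_mul _), integral_const_mul] at hmain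
  rw [← mul_le_mul_iff_right₀ he]
  refine le_trans (le_of_eq ?_) (hmain.trans (le_of_eq (by ring)))
  rw [← abs_of_pos he, ← abs_mul, abs_of_pos he]
  congr 1
  field_simp

/-- Mixing: asymptotically, a function of the current state is independent of the fluctuation
process, which vanishes. -/
theorem tendsto_integral_mul_comp (hD : IsDriver P v π x X μ φ M d α)
    {w : ℝ → ℝ} (hw : Measurable w) (hw1 : ∀ s, |w s| ≤ 1) {r : ℝ} (hr : 0 < r)
    {p : ℝ → ℝ} (hp : Continuous p) {L : ℝ}
    (hL : ∀ a ∈ Set.Icc (-(M * r)) (M * r), ∀ b ∈ Set.Icc (-(M * r)) (M * r),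
      |p a - p b| ≤ L * |a - b|)
    {h : S → ℝ} (hh : Measurable h) {c : ℝ} (hc : 0 < c) (hv : ∀ y, |h y| ≤ c * v y) :
    Tendsto (fun e => ∫ ω, p (fluctuation φ w X e r ω) * h (fastState X e r ω) ∂μ) (𝓝[>] 0)
      (𝓝 (p 0 * ∫ y, h y ∂π)) := by
  set κ := ∫ y, v y ∂π + d * v x with hκ
  obtain ⟨B, hB⟩ := (isCompact_Icc (a := -(M * r)) (b := M * r)).exists_bound_of_continuousOn
    hp.continuousOn
  have hMr : 0 ≤ M * r := mul_nonneg hD.bdd_pos.le hr.le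
  have h0mem : (0 : ℝ) ∈ Set.Icc (-(M * r)) (M * r) := ⟨by linarith, hMr⟩
  have hB0 : 0 ≤ B := (norm_nonneg _).trans (hB 0 h0mem)
  have hL0 : 0 ≤ L := by
    have h1 := hL (M * r) ⟨by linarith, le_rfl⟩ 0 h0mem
    rw [sub_zero, abs_of_nonneg hMr] at h1
    have hMr' : 0 < M * r := mul_pos hD.bdd_pos hr
    by_contra hneg
    have := (abs_nonneg _).trans h1
    nlinarith
  have hκ0 : 0 ≤ κ := hD.moment_nonneg
  rw [tendsto_iff_norm_sub_tendsto_zero]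
  let C : ℝ := 1 + 2 * M * (M * d * (1 / α)) * κ * r
  -- The three errors come from moving the fluctuation back to an earlier time, from mixing over the
  -- gap, and from replacing the fluctuation by zero.
  have hlim : Tendsto (fun e : ℝ => L * (M * √e) * c * κ +
      (B * (c * d * Real.exp (-α * (√e)⁻¹)) * κ + L * (√e * C) * |∫ y, h y ∂π|)) (𝓝[>] 0)
      (𝓝 0) := by
    have hs : Tendsto (fun e : ℝ => √e) (𝓝[>] 0) (𝓝 0) := by
      have := (Real.continuous_sqrt.tendsto 0).mono_left (nhdsWithin_le_nhds (s := Set.Ioi 0))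
      rwa [Real.sqrt_zero] at this
    have hs' : Tendsto (fun e : ℝ => √e) (𝓝[>] 0) (𝓝[>] 0) :=
      tendsto_nhdsWithin_iff.2 ⟨hs, by
        filter_upwards [self_mem_nhdsWithin] with e he using Real.sqrt_pos.2 he⟩
    have hexp : Tendsto (fun e : ℝ => Real.exp (-α * (√e)⁻¹)) (𝓝[>] 0) (𝓝 0) :=
      Real.tendsto_exp_atBot.comp ((tendsto_inv_nhdsGT_zero.comp hs').const_mul_atTop_of_neg
        (neg_lt_zero.2 hD.rate_pos))
    have := (((hs.const_mul M).const_mul L).mul_const c).mul_const κ |>.add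
      ((((hexp.const_mul (c * d)).const_mul B).mul_const κ).add
        (((hs.mul_const C).const_mul L).mul_const |∫ y, h y ∂π|))
    simpa using this
  refine squeeze_zero' (Eventually.of_forall fun _ => norm_nonneg _) ?_ hlim
  have hsmall : ∀ᶠ e : ℝ in 𝓝[>] 0, e < r ^ 2 :=
    nhdsWithin_le_nhds (gt_mem_nhds (by positivity))
  filter_upwards [self_mem_nhdsWithin, hsmall] with e (he : 0 < e) her
  have hse : 0 < √e := Real.sqrt_pos.2 he
  have hsr : √e < r := by
    rw [← Real.sqrt_sq hr.le]; exact Real.sqrt_lt_sqrt he.le her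
  -- A gap √e is short for the fluctuation process, which moves by at most M√e, but long for the
  -- driver, for which it lasts √e / e = 1/√e. The condition `e < r ^ 2` keeps `q` positive.
  set q := r - √e with hq
  have hq0 : 0 ≤ q := by linarith
  have hqr : q ≤ r := by linarith
  have hYm : ∀ s, Measurable fun ω => fluctuation φ w X e s ω := fun s =>
    (hD.measurable_fluctuation e hw hw1).comp (measurable_const.prodMk measurable_id)
  have hmem : ∀ s, 0 ≤ s → s ≤ r → ∀ ω,
      fluctuation φ w X e s ω ∈ Set.Icc (-(M * r)) (M * r) := fun s hs hsr ω =>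
    abs_le.1 ((hD.abs_fluctuation_le e hw hw1 hs ω).trans
      (mul_le_mul_of_nonneg_left hsr hD.bdd_pos.le))
  have hpm : ∀ s, Measurable fun ω => p (fluctuation φ w X e s ω) := fun s =>
    hp.measurable.comp (hYm s)
  have hpb : ∀ s, 0 ≤ s → s ≤ r → ∀ᵐ ω ∂μ, |p (fluctuation φ w X e s ω)| ≤ B :=
    fun s hs hsr => Eventually.of_forall fun ω => hB _ (hmem s hs hsr ω)
  have hhi : Integrable (fun ω => h (fastState X e r ω)) μ := hD.integrable_comp hh hv _
  have hi : ∀ s, 0 ≤ s → s ≤ r →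
      Integrable (fun ω => p (fluctuation φ w X e s ω) * h (fastState X e r ω)) μ :=
    fun s hs hsr => hhi.bdd_mul (hpm s).aestronglyMeasurable (by simpa using hpb s hs hsr)
  have hpi : Integrable (fun ω => p (fluctuation φ w X e q ω)) μ :=
    Integrable.of_bound (hpm q).aestronglyMeasurable B (by simpa using hpb q hq0 hqr)
  -- replacing the time `r` by `q` in the fluctuation process
  have b1 : |∫ ω, (p (fluctuation φ w X e r ω) - p (fluctuation φ w X e q ω)) *
      h (fastState X e r ω) ∂μ| ≤ L * (M * √e) * c * κ := by
    refine hD.abs_integral_mul_le (s := (r / e).toNNReal) (Eventually.of_forall fun ω => ?_)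
      (mul_nonneg hL0 (mul_nonneg hD.bdd_pos.le hse.le)) hc.le (fun ω => hv _)
    refine (hL _ (hmem r hr.le le_rfl ω) _ (hmem q hq0 hqr ω)).trans
      (mul_le_mul_of_nonneg_left ?_ hL0)
    have h1 := hD.abs_fluctuation_sub_le e hw hw1 q r ω
    rwa [show r - q = √e by rw [hq]; ring, abs_of_pos hse] at h1
  -- mixing over the time `√e / e`
  have hmk := hD.markov.integral_mul_eq (q / e).toNNReal ((r - q) / e).toNNReal hh
    (hD.integrable_comp hh hv _)
    (hp.comp_aestronglyMeasurable
      (hD.aestronglyMeasurable_fluctuation he hw hw1 hq0 (le_refl q)))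
    (hpb q hq0 hqr)
  rw [toNNReal_div_add he hq0 hqr] at hmk
  have hdec : ∀ ω, |expect P h ((r - q) / e).toNNReal (fastState X e q ω) - ∫ y, h y ∂π| ≤
      (c * d * Real.exp (-α * (√e)⁻¹)) * v (fastState X e q ω) := fun ω => by
    have h1 := hD.abs_expect_sub_le hh hc hv ((r - q) / e).toNNReal (fastState X e q ω)
    have h2 : (r - q) / e = (√e)⁻¹ := by
      rw [show r - q = √e by rw [hq]; ring, div_eq_iff he.ne', eq_comm, inv_mul_eq_iff_eq_mul₀ hse.ne']
      exact (Real.mul_self_sqrt he.le).symm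
    rw [h2, Real.coe_toNNReal _ (inv_nonneg.2 hse.le)] at h1
    rw [h2]
    exact h1.trans (le_of_eq (by ring))
  have b2 : |∫ ω, p (fluctuation φ w X e q ω) *
      (expect P h ((r - q) / e).toNNReal (fastState X e q ω) - ∫ y, h y ∂π) ∂μ| ≤
      B * (c * d * Real.exp (-α * (√e)⁻¹)) * κ :=
    hD.abs_integral_mul_le (s := (q / e).toNNReal) (hpb q hq0 hqr) hB0
      (mul_nonneg (mul_nonneg hc.le hD.const_nonneg) (Real.exp_nonneg _)) hdec
  -- the fluctuation process vanishes
  have hYi : Integrable (fun ω => fluctuation φ w X e q ω) μ :=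
    Integrable.of_bound (hYm q).aestronglyMeasurable (M * q)
      (Eventually.of_forall fun ω => hD.abs_fluctuation_le e hw hw1 hq0 ω)
  have b3 : |(∫ ω, p (fluctuation φ w X e q ω) ∂μ) - p 0| ≤ L * (√e * C) := by
    have h1 : (∫ ω, p (fluctuation φ w X e q ω) ∂μ) - p 0 =
        ∫ ω, (p (fluctuation φ w X e q ω) - p 0) ∂μ := by
      rw [integral_sub hpi (integrable_const _)]; simp
    have h2 : ‖∫ ω, (p (fluctuation φ w X e q ω) - p 0) ∂μ‖ ≤
        ∫ ω, L * |fluctuation φ w X e q ω| ∂μ := by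
      refine norm_integral_le_of_norm_le (hYi.abs.const_mul L) (Eventually.of_forall fun ω => ?_)
      have := hL _ (hmem q hq0 hqr ω) 0 h0mem
      rwa [sub_zero] at this
    rw [integral_const_mul] at h2
    rw [h1]
    refine h2.trans (mul_le_mul_of_nonneg_left
      ((hD.integral_abs_fluctuation_le he hw hw1 hq0).trans ?_) hL0)
    refine mul_le_mul_of_nonneg_left ?_ hse.le
    have h3 : 0 ≤ 2 * M * (M * d * (1 / α)) * κ := by
      have := hD.bdd_pos; have := hD.const_nonneg; have := hD.rate_pos
      positivity
    have h4 := mul_le_mul_of_nonneg_left hqr h3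
    simp only [C]
    linarith
  have hhq : Integrable (fun ω => expect P h ((r - q) / e).toNNReal (fastState X e q ω)) μ := by
    have hm : Measurable fun ω => expect P h ((r - q) / e).toNNReal (fastState X e q ω) :=
      (measurable_expect hh).comp (measurable_const.prodMk (hD.markov.measurable_apply _))
    have h1 : Integrable (fun ω =>
        expect P h ((r - q) / e).toNNReal (fastState X e q ω) - ∫ y, h y ∂π) μ :=
      ((hD.integrable_weight (q / e).toNNReal).const_mul _).mono'
        (hm.sub_const _).aestronglyMeasurable (Eventually.of_forall hdec)
    exact (h1.add (integrable_const (∫ y, h y ∂π))).congr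
      (Eventually.of_forall fun ω => sub_add_cancel _ _)
  have hpe : Integrable (fun ω => p (fluctuation φ w X e q ω) *
      expect P h ((r - q) / e).toNNReal (fastState X e q ω)) μ :=
    hhq.bdd_mul (hpm q).aestronglyMeasurable (by simpa using hpb q hq0 hqr)
  have hsplit : (∫ ω, p (fluctuation φ w X e r ω) * h (fastState X e r ω) ∂μ) -
      p 0 * ∫ y, h y ∂π =
      (∫ ω, (p (fluctuation φ w X e r ω) - p (fluctuation φ w X e q ω)) *
        h (fastState X e r ω) ∂μ) +
      ((∫ ω, p (fluctuation φ w X e q ω) *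
        (expect P h ((r - q) / e).toNNReal (fastState X e q ω) - ∫ y, h y ∂π) ∂μ) +
      ((∫ ω, p (fluctuation φ w X e q ω) ∂μ) - p 0) * ∫ y, h y ∂π) := by
    simp only [sub_mul, mul_sub]
    rw [integral_sub (hi r hr.le le_rfl) (hi q hq0 hqr), integral_sub hpe (hpi.mul_const _),
      integral_mul_const]
    have hmk' : ∫ ω, p (fluctuation φ w X e q ω) * h (fastState X e r ω) ∂μ =
        ∫ ω, p (fluctuation φ w X e q ω) *
          expect P h ((r - q) / e).toNNReal (fastState X e q ω) ∂μ := hmk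
    rw [hmk']
    ring
  rw [hsplit]
  refine (norm_add_le _ _).trans (add_le_add b1 ((norm_add_le _ _).trans (add_le_add b2 ?_)))
  rw [norm_mul]
  exact mul_le_mul_of_nonneg_right b3 (norm_nonneg _)

end IsDriver

/-- First order expansion of the expectation of a smooth function of the fluctuation process. -/
theorem IsDriver.tendsto_expansion {S Ω : Type*} [MeasurableSpace S] {mΩ : MeasurableSpace Ω}
    {μ : Measure Ω} [IsProbabilityMeasure μ] {P : Kernel (ℝ≥0 × S) S} [IsMarkovKernel P]
    {v : S → ℝ} {π : Measure S} {x : S} {X : ℝ≥0 → Ω → S} {φ : S → ℝ} {M d α : ℝ}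
    (hD : IsDriver P v π x X μ φ M d α) {w : ℝ → ℝ} (hw : Continuous w) (hw1 : ∀ s, |w s| ≤ 1)
    {t : ℝ} (ht : 0 < t) {ψ ψ' ψ'' : ℝ → ℝ} (hψ : ∀ y, HasDerivAt ψ (ψ' y) y)
    (hψ' : ∀ y, HasDerivAt ψ' (ψ'' y) y) (hψ'' : ContDiff ℝ 1 ψ'') :
    Tendsto (fun e => ((∫ ω, ψ (fluctuation φ w X e t ω) ∂μ) - ψ 0) / e) (𝓝[>] 0)
      (𝓝 (ψ' 0 * (w 0 * green P φ x) +
        (ψ'' 0 * ∫ y, φ y * green P φ y ∂π) * ∫ r in (0 : ℝ)..t, w r ^ 2)) := by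
  set κ := ∫ y, v y ∂π + d * v x with hκ
  have hwm := hw.measurable
  have hc := hψ''.continuous
  have hM0 := hD.bdd_pos.le
  obtain ⟨B, hB⟩ := (isCompact_Icc (a := -(M * t)) (b := M * t)).exists_bound_of_continuousOn
    hc.continuousOn
  have hMt : 0 ≤ M * t := mul_nonneg hM0 ht.le
  have hB0 : 0 ≤ B := (norm_nonneg _).trans (hB 0 ⟨by linarith, hMt⟩)
  obtain ⟨L, hL⟩ := hψ''.contDiffOn.exists_lipschitzOnWith (by decide)
      (convex_Icc (-(M * t)) (M * t)) isCompact_Icc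
  have hYm := fun e => hD.measurable_fluctuation e hwm hw1
  have hρ : ∀ r < t, Tendsto (fun e => M * d * weightModulus α w t e r) (𝓝[>] 0) (𝓝 0) :=
    fun r hr => by
      simpa using (tendsto_weightModulus hw hw1 hD.rate_pos hr).const_mul (M * d)
  have hmem : ∀ e r, 0 ≤ r → r ≤ t → ∀ ω,
      fluctuation φ w X e r ω ∈ Set.Icc (-(M * t)) (M * t) := fun e r hr hrt ω =>
    abs_le.1 ((hD.abs_fluctuation_le e hwm hw1 hr ω).trans (mul_le_mul_of_nonneg_left hrt hM0))
  -- the mean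
  have hmean : Tendsto (fun e => (∫ ω, fluctuation φ w X e t ω ∂μ) / e) (𝓝[>] 0)
      (𝓝 (w 0 * green P φ x)) := by
    rw [tendsto_iff_norm_sub_tendsto_zero]
    have hlim := ((hρ 0 ht).const_mul 1).mul_const κ
    rw [mul_zero, zero_mul] at hlim
    refine squeeze_zero' (Eventually.of_forall fun _ => norm_nonneg _) ?_ hlim
    filter_upwards [self_mem_nhdsWithin] with e (he : 0 < e)
    have h := hD.abs_integral_increment_sub_green_le he hwm hw1 le_rfl ht.le (W := fun _ => 1)
      (B := 1) aestronglyMeasurable_const (Eventually.of_forall fun _ => by simp) zero_le_one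
    have h0 : ∫ ω, green P φ (fastState X e 0 ω) ∂μ = green P φ x := by
      have : (fun ω => green P φ (fastState X e 0 ω)) =ᵐ[μ] fun _ => green P φ x := by
        filter_upwards [hD.markov.initial] with ω hω
        simp [fastState, hω]
      rw [integral_congr_ae this]; simp
    simp only [one_mul, h0] at h
    have h1 : ∀ ω, fluctuation φ w X e t ω - fluctuation φ w X e 0 ω = fluctuation φ w X e t ω :=
      fun ω => by simp [fluctuation]
    simp only [h1] at h
    rw [one_mul]
    exact h
  -- the second order term
  have hsecond : Tendsto (fun e => ∫ q in (0 : ℝ)..t,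
      (∫ ω, ψ'' (fluctuation φ w X e q ω) * (φ (fastState X e q ω) * w q) *
        (fluctuation φ w X e t ω - fluctuation φ w X e q ω) ∂μ) / e) (𝓝[>] 0)
      (𝓝 (∫ q in (0 : ℝ)..t, (ψ'' 0 * ∫ y, φ y * green P φ y ∂π) * w q ^ 2)) := by
    have hWm : ∀ e q, 0 < e → 0 ≤ q → AEStronglyMeasurable[pastSigma X (q / e).toNNReal]
        (fun ω => ψ'' (fluctuation φ w X e q ω) * (φ (fastState X e q ω) * w q)) μ := by
      intro e q he hq
      refine (hc.comp_aestronglyMeasurable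
        (hD.aestronglyMeasurable_fluctuation he hwm hw1 hq le_rfl)).mul ?_
      exact (Measurable.mul_const (hD.measurable.comp
        (measurable_pastSigma X le_rfl)) _).aestronglyMeasurable
    have hWb : ∀ e q, 0 ≤ q → q ≤ t →
        ∀ᵐ ω ∂μ, |ψ'' (fluctuation φ w X e q ω) * (φ (fastState X e q ω) * w q)| ≤ B * M :=
      fun e q hq hqt => Eventually.of_forall fun ω => by
        rw [abs_mul]
        exact mul_le_mul (hB _ (hmem e q hq hqt ω)) (hD.abs_integrand_le e hw1 q ω)
          (abs_nonneg _) hB0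
    -- The order-`e` bound on past-against-future expectations cancels the division by `e`, leaving
    -- a constant dominating function.
    refine intervalIntegral.tendsto_integral_filter_of_dominated_convergence
      (fun _ => B * M * (M * d * (1 / α)) * κ) (Eventually.of_forall fun e => ?_) ?_
      intervalIntegrable_const ?_
    · have hm : Measurable fun p : ℝ × Ω => ψ'' (fluctuation φ w X e p.1 p.2) *
          (φ (fastState X e p.1 p.2) * w p.1) *
            (fluctuation φ w X e t p.2 - fluctuation φ w X e p.1 p.2) :=
        ((hc.measurable.comp (hYm e)).mul (hD.measurable_integrand e hwm)).mul
          (((hYm e).comp (measurable_const.prodMk measurable_snd)).sub (hYm e))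
      exact ((hm.stronglyMeasurable.integral_prod_right' (ν := μ)).measurable.div_const
        e).aestronglyMeasurable
    · filter_upwards [self_mem_nhdsWithin] with e (he : 0 < e)
      refine Eventually.of_forall fun q hq => ?_
      rw [Set.uIoc_of_le ht.le] at hq
      have h := hD.abs_integral_mul_increment_le he hwm hw1 hq.1.le hq.2 (hWm e q he hq.1.le)
        (hWb e q hq.1.le hq.2) (mul_nonneg hB0 hM0)
      rw [norm_div, Real.norm_of_nonneg he.le, div_le_iff₀ he]
      exact h.trans (le_of_eq (by ring))
    · have hne : ∀ᵐ q : ℝ, q ≠ t := by simp [ae_iff, measure_singleton]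
      filter_upwards [hne] with q hqne hq
      rw [Set.uIoc_of_le ht.le] at hq
      have hqt : q < t := lt_of_le_of_ne hq.2 hqne
      -- The added 1 keeps the domination constant positive when `d = 0`.
      have hcpos : 0 < M * (M * d * (1 / α)) + 1 := by
        have := hD.const_nonneg; have := hD.rate_pos; positivity
      have hsub : ∀ a ∈ Set.Icc (-(M * q)) (M * q), a ∈ Set.Icc (-(M * t)) (M * t) :=
        fun a ha => by
          have := mul_le_mul_of_nonneg_left hq.2 hM0
          exact ⟨by linarith [ha.1], by linarith [ha.2]⟩
      have hmix := hD.tendsto_integral_mul_comp hwm hw1 hq.1 hc (L := L)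
        (fun a ha b hb => by
          have := hL.dist_le_mul a (hsub a ha) b (hsub b hb)
          simpa [Real.dist_eq] using this)
        (h := fun y => φ y * green P φ y) (hD.measurable.mul hD.measurable_green) hcpos
        (fun y => by
          have h1 := mul_le_mul (hD.bdd y) (hD.abs_green_le y) (abs_nonneg _) hM0
          rw [abs_mul]
          nlinarith [hD.weight_nonneg y])
      have hmain := hmix.mul_const (w q ^ 2)
      -- The increment contributes w(q) · `green` and the past factor contributes φ · w(q): this is
      -- where w(q)² arises, and mixing then applies to φ · `green`.
      have hdiff : Tendsto (fun e =>
          (∫ ω, ψ'' (fluctuation φ w X e q ω) * (φ (fastState X e q ω) * w q) *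
            (fluctuation φ w X e t ω - fluctuation φ w X e q ω) ∂μ) / e -
          (∫ ω, ψ'' (fluctuation φ w X e q ω) *
            (φ (fastState X e q ω) * green P φ (fastState X e q ω)) ∂μ) * w q ^ 2)
          (𝓝[>] 0) (𝓝 0) := by
        rw [tendsto_zero_iff_norm_tendsto_zero]
        have hlim := ((hρ q hqt).const_mul (B * M)).mul_const κ
        rw [mul_zero, zero_mul] at hlim
        refine squeeze_zero' (Eventually.of_forall fun _ => norm_nonneg _) ?_ hlim
        filter_upwards [self_mem_nhdsWithin] with e (he : 0 < e)
        have h := hD.abs_integral_increment_sub_green_le he hwm hw1 hq.1.le hq.2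
          (hWm e q he hq.1.le) (hWb e q hq.1.le hq.2) (mul_nonneg hB0 hM0)
        have e1 : w q * ∫ ω, ψ'' (fluctuation φ w X e q ω) * (φ (fastState X e q ω) * w q) *
            green P φ (fastState X e q ω) ∂μ = (∫ ω, ψ'' (fluctuation φ w X e q ω) *
              (φ (fastState X e q ω) * green P φ (fastState X e q ω)) ∂μ) * w q ^ 2 := by
          rw [← integral_const_mul, ← integral_mul_const]
          congr 1; funext ω; ring
        rw [e1] at h
        exact h
      have := hdiff.add hmain
      simpa using this
  rw [intervalIntegral.integral_const_mul] at hsecond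
  refine ((hmean.const_mul (ψ' 0)).add hsecond).congr' ?_
  filter_upwards [self_mem_nhdsWithin] with e (he : 0 < e)
  rw [hD.integral_taylor e hwm hw1 ht.le hψ hψ' hc, intervalIntegral.integral_div]
  ring

/-! ### Poisson weights -/

/-- The derivative of `poissonWeight` in the mean. -/
noncomputable def poissonWeightDeriv (k : ℕ) (a : ℝ) : ℝ :=
  Real.exp (-a) * (k * a ^ (k - 1) - a ^ k) / k.factorial

/-- The second derivative of `poissonWeight` in the mean. -/
noncomputable def poissonWeightDeriv₂ (k : ℕ) (a : ℝ) : ℝ :=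
  Real.exp (-a) * (k * ((k - 1 : ℕ) * a ^ (k - 1 - 1)) - 2 * (k * a ^ (k - 1)) + a ^ k) /
    k.factorial

theorem hasDerivAt_poissonWeight (k : ℕ) (a : ℝ) :
    HasDerivAt (fun a => poissonWeight a k) (poissonWeightDeriv k a) a := by
  have h := (((hasDerivAt_neg a).exp).mul (hasDerivAt_pow k a)).div_const (k.factorial : ℝ)
  refine h.congr_deriv ?_
  simp only [poissonWeightDeriv]
  ring

theorem hasDerivAt_poissonWeightDeriv (k : ℕ) (a : ℝ) :
    HasDerivAt (poissonWeightDeriv k) (poissonWeightDeriv₂ k a) a := by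
  have h := (((hasDerivAt_neg a).exp).mul
    (((hasDerivAt_pow (k - 1) a).const_mul (k : ℝ)).sub (hasDerivAt_pow k a))).div_const
      (k.factorial : ℝ)
  refine h.congr_deriv ?_
  simp only [poissonWeightDeriv₂, Pi.sub_apply]
  ring

theorem contDiff_poissonWeightDeriv₂ (k : ℕ) : ContDiff ℝ 1 (poissonWeightDeriv₂ k) := by
  unfold poissonWeightDeriv₂
  fun_prop

/-- Factoring out the weight produces the relative correction of the final formula. The truncated
exponent at `k = 0` is harmless because its coefficient vanishes. -/
theorem poissonWeightDeriv_eq (k : ℕ) {a : ℝ} (ha : a ≠ 0) :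
    poissonWeightDeriv k a = poissonWeight a k * (k / a - 1) := by
  unfold poissonWeightDeriv poissonWeight
  rcases k with _ | k
  · simp
  · rw [Nat.add_sub_cancel, pow_succ]
    field_simp

theorem poissonWeightDeriv₂_eq (k : ℕ) {a : ℝ} (ha : a ≠ 0) :
    poissonWeightDeriv₂ k a =
      poissonWeight a k * (1 - 2 * k / a + k * (k - 1) / a ^ 2) := by
  unfold poissonWeightDeriv₂ poissonWeight
  rcases k with _ | _ | k
  · simp
  · simp
    field_simp
    ring
  · simp only [Nat.add_sub_cancel, pow_succ]
    push_cast
    field_simp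
    ring

theorem poissonWeight_pos {a : ℝ} (ha : 0 < a) (k : ℕ) : 0 < poissonWeight a k := by
  unfold poissonWeight; positivity

theorem hasSum_mul_poissonWeight (a : ℝ) :
    HasSum (fun n : ℕ => (n : ℝ) * poissonWeight a n) a := by
  have h1 : HasSum (fun n => poissonWeight a n) 1 := by
    simpa using hasSum_pow_mul_poissonWeight a 1
  have h2 : HasSum (fun n : ℕ => ((n + 1 : ℕ) : ℝ) * poissonWeight a (n + 1)) a := by
    have h3 := h1.mul_left a
    rw [mul_one] at h3
    have e : (fun n : ℕ => ((n + 1 : ℕ) : ℝ) * poissonWeight a (n + 1)) =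
        fun n => a * poissonWeight a n := by
      funext n
      simp only [poissonWeight, Nat.factorial_succ, pow_succ]
      push_cast
      field_simp
    rw [e]; exact h3
  have h4 := (hasSum_nat_add_iff (f := fun n : ℕ => (n : ℝ) * poissonWeight a n) 1).1 h2
  simpa using h4

theorem integral_natCast_eq_of_poisson {Ω : Type*} [MeasurableSpace Ω] {μ : Measure Ω}
    [IsProbabilityMeasure μ] {Q : Ω → ℕ} (hQ : AEMeasurable Q μ) {a : ℝ}
    (ha : 0 ≤ a) (h : ∀ k, μ.real {ω | Q ω = k} = poissonWeight a k) :
    ∫ ω, (Q ω : ℝ) ∂μ = a := by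
  have : IsProbabilityMeasure (μ.map Q) := Measure.isProbabilityMeasure_map hQ
  have hmap : μ.map Q = poissonMeasure a.toNNReal := by
    refine Measure.ext_of_singleton fun k => ?_
    have h1 : (μ.map Q).real {k} = (poissonMeasure a.toNNReal).real {k} := by
      rw [poissonMeasure_real_singleton_eq a ha, ← h k, measureReal_def,
        Measure.map_apply_of_aemeasurable hQ (measurableSet_singleton k)]
      rfl
    rwa [measureReal_def, measureReal_def, ENNReal.toReal_eq_toReal_iff' (by finiteness)
      (by finiteness)] at h1
  have h1 : ∫ ω, (Q ω : ℝ) ∂μ = ∫ n : ℕ, (n : ℝ) ∂(μ.map Q) :=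
    (integral_map hQ (measurable_of_countable _).aestronglyMeasurable).symm
  rw [h1, hmap, integral_poissonMeasure]
  refine Eq.trans ?_ (hasSum_mul_poissonWeight a).tsum_eq
  refine tsum_congr fun n => ?_
  rw [Real.coe_toNNReal _ ha, smul_eq_mul, mul_comm]; rfl

/-! ### Continuity of the service time tail -/

theorem IsServiceSequence.tail_zero {Ω : Type*} [MeasurableSpace Ω] {μ : Measure Ω}
    [IsProbabilityMeasure μ] {dens : ℝ → ℝ} {V : ℕ → Ω → ℝ} (hV : IsServiceSequence dens V μ) :
    tail (V 0) μ 0 = 1 := by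
  simp [hV.tail_eq le_rfl]

theorem IsServiceSequence.continuous_tail {Ω : Type*} [MeasurableSpace Ω] {μ : Measure Ω}
    [IsProbabilityMeasure μ] {dens : ℝ → ℝ} {V : ℕ → Ω → ℝ} (hV : IsServiceSequence dens V μ) :
    Continuous (tail (V 0) μ) := by
  have hI : Integrable ((Set.Ici (0 : ℝ)).indicator dens) volume :=
    (integrable_indicator_iff measurableSet_Ici).2 hV.integrableOn_density
  -- Nothing is known about `dens` on the negative axis, hence the indicator; clipping at 0
  -- reproduces the value 1 of the tail there.
  have hc : Continuous fun s => 1 - ∫ y in (0 : ℝ)..(max s 0), (Set.Ici (0 : ℝ)).indicator dens y :=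
    continuous_const.sub ((intervalIntegral.continuous_primitive
      (fun a b => hI.intervalIntegrable) 0).comp (continuous_id.max continuous_const))
  convert hc using 1
  funext s
  have h0 : ∀ s, 0 ≤ s → ∫ y in (0 : ℝ)..s, (Set.Ici (0 : ℝ)).indicator dens y =
      ∫ y in (0 : ℝ)..s, dens y := fun s hs =>
    intervalIntegral.integral_congr fun y hy => by
      rw [Set.uIcc_of_le hs] at hy
      exact Set.indicator_of_mem (show y ∈ Set.Ici (0 : ℝ) from hy.1) _
  rw [h0 _ (le_max_right _ _), ← hV.tail_eq (le_max_right _ _)]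
  rcases le_total 0 s with hs | hs
  · rw [max_eq_left hs]
  · rw [max_eq_right hs, hV.tail_zero]
    refine le_antisymm (tail_le_one _ _) ?_
    rw [← hV.tail_zero]
    exact tail_antitone _ hs

/-! ### The arrival processes -/

/-- Averaging the conditional law of the increments over the driving process puts the Cox process in
the mixed Poisson form used by `numberInSystem_law`. -/
theorem IsCoxProcess.measureReal_increments {S Ω : Type*} [MeasurableSpace S]
    [MeasurableSpace Ω] {μ : Measure Ω} [IsProbabilityMeasure μ] {P : Kernel (ℝ≥0 × S) S} {x : S}
    {X : ℝ≥0 → Ω → S} (hX : IsMarkovProcessFrom P x X μ) {lam : ℝ≥0 → Ω → ℝ} {N : ℝ≥0 → Ω → ℕ}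
    (hN : IsCoxProcess X lam N μ) (m : ℕ) (τ : Fin (m + 1) → ℝ≥0) (hτ : Monotone τ)
    (j : Fin m → ℕ) :
    μ.real {ω | ∀ i : Fin m, N (τ i.succ) ω = N (τ i.castSucc) ω + j i} =
      ∫ ω, ∏ i : Fin m, poissonWeight
        (∫ s in (τ i.castSucc : ℝ)..(τ i.succ : ℝ), lam s.toNNReal ω) (j i) ∂μ := by
  have hm : MeasurableSet {ω | ∀ i : Fin m, N (τ i.succ) ω = N (τ i.castSucc) ω + j i} := by
    rw [Set.ofPred_forall]
    exact MeasurableSet.iInter fun i => measurableSet_eq_fun (hN.counting.measurable _)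
      ((hN.counting.measurable _).add_const _)
  rw [← integral_congr_ae (hN.increments m τ hτ j), integral_condExp hX.pathSigma_le,
    integral_indicator hm]
  simp

end RapidQueue

/-! ### The expansion of the queue length distribution -/

theorem theorem4
    {S : Type*} [TopologicalSpace S] [PolishSpace S] [MeasurableSpace S] [BorelSpace S]
    {Ω : Type*} [MeasurableSpace Ω] (μ : Measure Ω) [IsProbabilityMeasure μ]
    -- the geometrically ergodic Markov process `X`, started at `x`
    (P : Kernel (ℝ≥0 × S) S) (hP : RapidQueue.IsTransitionFunction P)
    (v : S → ℝ) (π : Measure S) (hπ : RapidQueue.IsGeometricallyErgodic P v π)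
    (x : S) (X : ℝ≥0 → Ω → S) (hX : RapidQueue.IsMarkovProcessFrom P x X μ)
    -- the intensity function
    (f : S → ℝ) (hf_meas : Measurable f) (hf_nonneg : ∀ y, 0 ≤ f y)
    (hf_bdd : ∃ C : ℝ, ∀ y, f y ≤ C) (hf_pos : 0 < ∫ y, f y ∂π)
    -- the arrival processes
    (N : ℝ≥0 → ℝ≥0 → Ω → ℕ)
    (hN : ∀ ε : ℝ≥0, 0 < ε → ε ≤ 1 →
      RapidQueue.IsCoxProcess X (fun s ω => f (X (s / ε) ω)) (N ε) μ)
    (N₀ : ℝ≥0 → Ω → ℕ) (hN₀ : RapidQueue.IsPoissonProcess (∫ y, f y ∂π) N₀ μ)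
    -- the service times
    (dens : ℝ → ℝ) (V : ℕ → Ω → ℝ) (hV : RapidQueue.IsServiceSequence dens V μ)
    (hVN : ∀ ε : ℝ≥0, 0 < ε → ε ≤ 1 →
      IndepFun (fun ω n => V n ω) (fun ω s => N ε s ω) μ)
    (hVN₀ : IndepFun (fun ω n => V n ω) (fun ω s => N₀ s ω) μ)
    (t : ℝ≥0) (ht : 0 < t) (k : ℕ) :
    let Q : ℝ≥0 → Ω → ℕ := fun ε => RapidQueue.numberInSystem (N ε) V t
    let Q₀ : Ω → ℕ := RapidQueue.numberInSystem N₀ V t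
    let EQ₀ : ℝ := ∫ ω, (Q₀ ω : ℝ) ∂μ
    let g : S → ℝ := RapidQueue.potential P f π
    let Kbar : ℝ → ℝ := RapidQueue.tail (V 0) μ
    let η2 : ℝ := RapidQueue.etaSq (RapidQueue.sigmaSq P f π) Kbar dens t
    ∃ o : ℝ≥0 → ℝ, o =o[𝓝[>] (0 : ℝ≥0)] (fun ε : ℝ≥0 => (ε : ℝ)) ∧
      ∀ ε : ℝ≥0, 0 < ε → ε ≤ 1 →
        μ.real {ω | Q ε ω = k} = μ.real {ω | Q₀ ω = k} *
          (1 + (ε : ℝ) * (((k : ℝ) / EQ₀ - 1) * g x * Kbar t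
              + 1 / 2 * (1 - 2 * (k : ℝ) / EQ₀ + (k : ℝ) * ((k : ℝ) - 1) / EQ₀ ^ 2) * η2)
            + o ε) := by
  intro Q Q₀ EQ₀ g Kbar η2
  have : IsMarkovKernel P := hP.markovKernel
  have : IsProbabilityMeasure π := hπ.isProbabilityMeasure
  obtain ⟨C, hC⟩ := hf_bdd
  set lam : ℝ := ∫ y, f y ∂π with hlam
  have hC0 : 0 ≤ C := (hf_nonneg x).trans (hC x)
  have hfi : Integrable f π := Integrable.of_bound hf_meas.aestronglyMeasurable C
    (Eventually.of_forall fun y => by rw [Real.norm_of_nonneg (hf_nonneg y)]; exact hC y)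
  have hlamC : lam ≤ C := by
    have := integral_mono hfi (integrable_const C) hC
    simpa using this
  have htr : (0 : ℝ) < t := ht
  -- the driver
  let φ : S → ℝ := RapidQueue.centered f π
  obtain ⟨d, α, hα, hbound⟩ := hπ.bound
  -- Testing the ergodicity bound on h = 0 at time 0 forces the constant to be nonnegative.
  have hd : 0 ≤ d := by
    have h := (abs_nonneg _).trans (hbound (fun _ => 0) measurable_const
      (fun y => by simpa using zero_le_one.trans (hπ.one_le y)) 0 x)
    simp only [NNReal.coe_zero, mul_zero, Real.exp_zero, mul_one] at h
    exact nonneg_of_mul_nonneg_left h (zero_lt_one.trans_le (hπ.one_le x))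
  have hD : RapidQueue.IsDriver P v π x X μ φ (C + 1) d α :=
    { markov := hX
      ergodic := hπ
      rate_pos := hα
      const_nonneg := hd
      bound := hbound
      measurable := hf_meas.sub_const _
      bdd_pos := by linarith
      bdd := fun y => abs_le.2 ⟨by
        change -(C + 1) ≤ f y - lam
        linarith [hf_nonneg y], by
        change f y - lam ≤ C + 1
        linarith [hC y]⟩
      mean_zero := by
        change ∫ y, (f y - lam) ∂π = 0
        rw [integral_sub hfi (integrable_const _)]
        simp [hlam] }
  -- the weight
  let w : ℝ → ℝ := fun s => Kbar (t - s)
  have hKc : Continuous Kbar := hV.continuous_tail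
  have hwc : Continuous w := hKc.comp (by fun_prop)
  have hK0 : ∀ s, 0 ≤ Kbar s := RapidQueue.tail_nonneg _
  have hw1 : ∀ s, |w s| ≤ 1 := fun s => by
    rw [abs_of_nonneg (hK0 _)]; exact RapidQueue.tail_le_one _ _
  -- the stationary queue
  set m : ℝ := ∫ s in (0 : ℝ)..t, lam * w s with hm
  have hm0 : 0 < m := by
    rw [hm, intervalIntegral.integral_const_mul]
    -- The weight is continuous, nonnegative and equal to K̄(0) = 1 at `s = t`, so its integral is
    -- positive whatever the service law.
    refine mul_pos hf_pos (intervalIntegral.integral_pos htr hwc.continuousOn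
      (fun s _ => hK0 _) ⟨t, ⟨htr.le, le_rfl⟩, ?_⟩)
    have : w t = 1 := by simp only [w, sub_self]; exact hV.tail_zero
    rw [this]; exact one_pos
  -- A constant intensity is the degenerate mixed Poisson case, so the same law covers both queues.
  have hlaw0 : ∀ k, μ.real {ω | Q₀ ω = k} = RapidQueue.poissonWeight m k := fun k => by
    have h := RapidQueue.numberInSystem_law hN₀.counting hV.measurable hV.indep hV.identDistrib
      hVN₀ (lam := fun _ _ => lam) measurable_const (fun _ _ => hf_pos.le) (fun _ _ => le_rfl)
      (fun n τ hτ j => by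
        rw [hN₀.increments n τ hτ j]
        simp [mul_comm]) t k
    rw [h]
    simp only [integral_const, probReal_univ, one_smul]
    rfl
  have hE : EQ₀ = m := RapidQueue.integral_natCast_eq_of_poisson
    (RapidQueue.aemeasurable_numberInSystem hN₀.counting hV.measurable t) hm0.le hlaw0
  -- the queue with rapidly changing intensity
  have hlaw : ∀ ε : ℝ≥0, 0 < ε → ε ≤ 1 → μ.real {ω | Q ε ω = k} =
      ∫ ω, RapidQueue.poissonWeight (m + RapidQueue.fluctuation φ w X ε t ω) k ∂μ := by
    intro ε hε hε1
    have hfast : ∀ (s : ℝ) ω, f (X (s.toNNReal / ε) ω) = f (RapidQueue.fastState X ε s ω) :=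
      fun s ω => by
        rw [RapidQueue.fastState, Real.toNNReal_div' ε.coe_nonneg, Real.toNNReal_coe]
    have h := RapidQueue.numberInSystem_law (hN ε hε hε1).counting hV.measurable hV.indep
      hV.identDistrib (hVN ε hε hε1) (lam := fun s ω => f (RapidQueue.fastState X ε s ω))
      (hf_meas.comp (hD.measurable_fastState ε)) (fun _ _ => hf_nonneg _) (fun _ _ => hC _)
      (fun n τ hτ j => by
        rw [(hN ε hε hε1).measureReal_increments hX n τ hτ j]
        simp only [hfast]) t k
    rw [h]
    congr 1
    funext ω
    congr 1
    have hi : IntervalIntegrable (fun s => φ (RapidQueue.fastState X ε s ω) * w s)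
        volume 0 t :=
      (intervalIntegrable_const (c := C + 1)).mono_fun
        ((hD.measurable_integrand ε hwc.measurable).comp
          (measurable_id.prodMk measurable_const)).aestronglyMeasurable
        (Eventually.of_forall fun s =>
          (hD.abs_integrand_le ε hw1 s ω).trans (le_abs_self _))
    rw [hm, RapidQueue.fluctuation, ← intervalIntegral.integral_add
      ((hwc.const_mul lam).intervalIntegrable _ _) hi]
    refine intervalIntegral.integral_congr fun s _ => ?_
    change f _ * w s = lam * w s + (f _ - lam) * w s
    ring
  -- the expansion
  have hexp := hD.tendsto_expansion hwc hw1 htr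
    (ψ := fun y => RapidQueue.poissonWeight (m + y) k)
    (ψ' := fun y => RapidQueue.poissonWeightDeriv k (m + y))
    (ψ'' := fun y => RapidQueue.poissonWeightDeriv₂ k (m + y))
    (fun y => (RapidQueue.hasDerivAt_poissonWeight k (m + y)).comp_const_add m y)
    (fun y => (RapidQueue.hasDerivAt_poissonWeightDeriv k (m + y)).comp_const_add m y)
    ((RapidQueue.contDiff_poissonWeightDeriv₂ k).comp (contDiff_const.add contDiff_id))
  simp only [add_zero] at hexp
  rw [RapidQueue.poissonWeightDeriv_eq k hm0.ne', RapidQueue.poissonWeightDeriv₂_eq k hm0.ne']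
    at hexp
  set p0 := RapidQueue.poissonWeight m k with hp0
  have hp0pos : 0 < p0 := RapidQueue.poissonWeight_pos hm0 k
  set A : ℝ := ((k : ℝ) / EQ₀ - 1) * g x * Kbar t
              + 1 / 2 * (1 - 2 * (k : ℝ) / EQ₀ + (k : ℝ) * ((k : ℝ) - 1) / EQ₀ ^ 2) * η2 with hA
  -- Time reversal s ↦ t - s matches the expansion's ∫ w² with the ∫ K̄² left by the integration by
  -- parts; the 2 in σ² cancels the 1/2 of the statement.
  have hη : η2 = 2 * (∫ y, φ y * RapidQueue.green P φ y ∂π) * ∫ r in (0 : ℝ)..t, w r ^ 2 := by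
    have h1 : ∫ r in (0 : ℝ)..t, w r ^ 2 = ∫ s in (0 : ℝ)..t, Kbar s ^ 2 := by
      have := intervalIntegral.integral_comp_sub_left (a := 0) (b := (t : ℝ))
        (fun s => Kbar s ^ 2) (t : ℝ)
      simpa [w] using this
    rw [h1]
    exact hV.etaSq_eq _ htr.le
  have hlimA : p0 * (k / m - 1) * (w 0 * RapidQueue.green P φ x) +
      p0 * (1 - 2 * k / m + k * (k - 1) / m ^ 2) *
        (∫ y, φ y * RapidQueue.green P φ y ∂π) * (∫ r in (0 : ℝ)..t, w r ^ 2) = p0 * A := by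
    have hw0 : w 0 = Kbar t := by simp [w]
    have hg : RapidQueue.green P φ x = g x := rfl
    rw [hA, hη, hE, hw0, hg]
    ring
  rw [hlimA] at hexp
  have hcoe : Tendsto (fun ε : ℝ≥0 => (ε : ℝ)) (𝓝[>] 0) (𝓝[>] 0) := by
    refine tendsto_nhdsWithin_iff.2 ⟨?_, ?_⟩
    · exact (NNReal.continuous_coe.tendsto 0).mono_left nhdsWithin_le_nhds
    · filter_upwards [self_mem_nhdsWithin] with ε hε using NNReal.coe_pos.2 hε
  -- The error is taken to be the exact relative remainder, so the identity is algebra (`p0` is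
  -- positive) and the content lies in the limit `hexp`.
  refine ⟨fun ε => μ.real {ω | Q ε ω = k} / p0 - 1 - ε * A, ?_, fun ε hε hε1 => ?_⟩
  · rw [isLittleO_iff_tendsto']
    · have h1 := ((hexp.comp hcoe).div_const p0).sub_const A
      rw [mul_div_cancel_left₀ _ hp0pos.ne', sub_self] at h1
      refine h1.congr' ?_
      have hlt : ∀ᶠ ε : ℝ≥0 in 𝓝[>] 0, ε < 1 := nhdsWithin_le_nhds (gt_mem_nhds one_pos)
      filter_upwards [self_mem_nhdsWithin, hlt] with ε (hε : 0 < ε) hε1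
      have hεr : (ε : ℝ) ≠ 0 := (NNReal.coe_pos.2 hε).ne'
      rw [hlaw ε hε hε1.le]
      simp only [Function.comp]
      field_simp
    · filter_upwards [self_mem_nhdsWithin] with ε (hε : 0 < ε) h0
      exact absurd h0 (NNReal.coe_pos.2 hε).ne'
  · rw [hlaw0 k, ← hp0]
    field_simp
    ring
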